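/- All digraphs are finite. A digraph $T$ is semi-complete if it has no loops and no parallel arcs and any two distinct vertices are joined by at least one arc. A separation of order $j$ in $T$ is a pair $(A,B)$ of vertex sets with $A\cup B=V(T)$, $|A\cap B|\le j$ and no arc from $A\setminus B$ to $B\setminus A$. A set $Z\subseteq V(T)$ is a $k$-jungle if $|Z|=k$ and for all $x,y\in Z$ there is no separation $(A,B)$ of order smaller than $k$ with $x\in A\setminus B$ and $y\in B\setminus A$. A $k$-triple is a triple $(A,B,C)$ of pairwise disjoint sets of $k$ vertices with orderings $(a_1,\dots,a_k)$, $(b_1,\dots,b_k)$, $(c_1,\dots,c_k)$ such that $(a_i,b_j)$, $(b_i,c_j)$ and $(c_i,a_i)$ are arcs for all $1\le i,j\le k$. **Lemma.** There are a (Kalmár) elementary function $f:\mathbb N\to\mathbb N$ and a single algorithm which, for every $k\ge 1$ and every semi-complete digraph $T$, given $k$, the adjacency matrix of $T$ and a list of the vertices of an $f(k)$-jungle of $T$, outputs a $k$-triple $(A,B,C)$ of $T$ in time $O(|V(T)|^3\log|V(T)|)$, where the constant hidden in the $O$-notation is absolute (in particular, independent of $k$). Time is counted in unit-cost steps of a random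 access machine with words of $O(\log |V(T)|)$ bits. -/

import Mathlib

/-! ### Elementary functions -/

/-- The (Kalmar) elementary functions on tuples of natural numbers: the smallest class containing
zero, successor, projections and truncated subtraction, closed under composition, bounded sums and
bounded products. In `bsum` and `bprod` the bound is the argument number `0`, and the other
arguments are parameters. -/
inductive KalmarElementary : {n : ℕ} → ((Fin n → ℕ) → ℕ) → Prop
  | zero {n : ℕ} : KalmarElementary (fun _ : Fin n → ℕ => 0)
  | succ : KalmarElementary (fun v : Fin 1 → ℕ => v 0 + 1)
  | proj {n : ℕ} (i : Fin n) : KalmarElementary (fun v : Fin n → ℕ => v i)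
  | sub : KalmarElementary (fun v : Fin 2 → ℕ => v 0 - v 1)
  | comp {m n : ℕ} {g : (Fin m → ℕ) → ℕ} {h : Fin m → (Fin n → ℕ) → ℕ} :
      KalmarElementary g → (∀ i, KalmarElementary (h i)) →
      KalmarElementary (fun v : Fin n → ℕ => g (fun i => h i v))
  | bsum {n : ℕ} {g : (Fin (n + 1) → ℕ) → ℕ} : KalmarElementary g →
      KalmarElementary (fun v : Fin (n + 1) → ℕ =>
        ∑ i ∈ Finset.range (v 0), g (Fin.cons i (Fin.tail v)))
  | bprod {n : ℕ} {g : (Fin (n + 1) → ℕ) → ℕ} : KalmarElementary g →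
      KalmarElementary (fun v : Fin (n + 1) → ℕ =>
        ∏ i ∈ Finset.range (v 0), g (Fin.cons i (Fin.tail v)))

/-- A function `ℕ → ℕ` is elementary. -/
def IsElementaryFun (f : ℕ → ℕ) : Prop :=
  KalmarElementary (fun v : Fin 1 → ℕ => f (v 0))

/-! ### Semi-complete digraphs, separations, jungles and triples -/

namespace Digraph

/-- No loops, and at least one arc between any two distinct vertices. (A `Digraph` has no
parallel arcs, so that it is simple as soon as it has no loops.) -/
def IsSemicomplete {V : Type*} (T : Digraph V) : Prop :=
  (∀ v, ¬ T.Adj v v) ∧ ∀ u v, u ≠ v → T.Adj u v ∨ T.Adj v u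

/-- `(A, B)` is a separation of order `k`: `A ∪ B = V`, `|A ∩ B| ≤ k`, and there is no arc from
`A \ B` to `B \ A`. -/
def IsSeparation {V : Type*} [Fintype V] [DecidableEq V] (T : Digraph V) (k : ℕ)
    (A B : Finset V) : Prop :=
  A ∪ B = Finset.univ ∧ (A ∩ B).card ≤ k ∧ ∀ a ∈ A \ B, ∀ b ∈ B \ A, ¬ T.Adj a b

/-- `Z` is a `k`-jungle: `|Z| = k`, and for all `x, y ∈ Z` no separation of order smaller than `k`
separates `y` from `x`. -/
def IsJungle {V : Type*} [Fintype V] [DecidableEq V] (T : Digraph V) (k : ℕ)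
    (Z : Finset V) : Prop :=
  Z.card = k ∧ ∀ x ∈ Z, ∀ y ∈ Z,
    ¬ ∃ j < k, ∃ A B : Finset V, T.IsSeparation j A B ∧ x ∈ A \ B ∧ y ∈ B \ A

/-- `(A, B, C)` is a `k`-triple: the three sets are pairwise disjoint, of size `k`, and they have
orderings `a`, `b`, `c` such that all arcs `(a i, b j)`, `(b i, c j)` and `(c i, a i)` are present
(an injection from `Fin k` into a set of size `k` is an ordering of it). -/
def IsTriple {V : Type*} [DecidableEq V] (T : Digraph V) (k : ℕ) (A B C : Finset V) : Prop :=
  Disjoint A B ∧ Disjoint B C ∧ Disjoint A C ∧ A.card = k ∧ B.card = k ∧ C.card = k ∧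
  ∃ a b c : Fin k ↪ V,
    Finset.univ.map a = A ∧ Finset.univ.map b = B ∧ Finset.univ.map c = C ∧
    (∀ i j, T.Adj (a i) (b j)) ∧ (∀ i j, T.Adj (b i) (c j)) ∧ ∀ i, T.Adj (c i) (a i)

end Digraph

/-! ### Random access machines with bounded words

Programs are written in structured form (sequences, conditionals and loops in place of jumps).
The memory consists of registers and of arrays; a program is a finite object, hence names finitely
many of them. Each executed instruction and each evaluated test costs one unit of time. -/

namespace WordRAM

/-- The contents of the registers and of the arrays (`arr a i` is cell `i` of array `a`). -/
structure State where
  reg : ℕ → ℕ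
  arr : ℕ → ℕ → ℕ

/-- Arithmetic operations; subtraction is truncated at `0` and division rounds down. -/
inductive Op
  | add | sub | mul | div

def Op.eval : Op → ℕ → ℕ → ℕ
  | add, a, b => a + b
  | sub, a, b => a - b
  | mul, a, b => a * b
  | div, a, b => a / b

/-- Instructions; `x`, `y`, `z`, `i` are names of registers, `a` is the name of an array. -/
inductive Instr
  /-- `x := c` -/
  | const (x c : ℕ)
  /-- `x := y` -/
  | copy (x y : ℕ)
  /-- `x := y o z` -/
  | arith (o : Op) (x y z : ℕ)
  /-- `x := a[i]` -/
  | load (x a i : ℕ)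
  /-- `a[i] := x` -/
  | store (a i x : ℕ)

/-- The effect of an instruction. -/
def Instr.run : Instr → State → State
  | const x c, s => { s with reg := Function.update s.reg x c }
  | copy x y, s => { s with reg := Function.update s.reg x (s.reg y) }
  | arith o x y z, s => { s with reg := Function.update s.reg x (o.eval (s.reg y) (s.reg z)) }
  | load x a i, s => { s with reg := Function.update s.reg x (s.arr a (s.reg i)) }
  | store a i x, s =>
      { s with arr := Function.update s.arr a (Function.update (s.arr a) (s.reg i) (s.reg x)) }

/-- Every number that the instruction computes is smaller than `W`, so it fits into a word.
(The other instructions only move words.) -/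
def Instr.Fits (W : ℕ) : Instr → State → Prop
  | const _ c, _ => c < W
  | arith o _ y z, s => o.eval (s.reg y) (s.reg z) < W
  | _, _ => True

/-- Comparison of the contents of two registers. -/
inductive Test
  | lt (x y : ℕ) | le (x y : ℕ) | eq (x y : ℕ) | ne (x y : ℕ)

def Test.Holds : Test → State → Prop
  | lt x y, s => s.reg x < s.reg y
  | le x y, s => s.reg x ≤ s.reg y
  | eq x y, s => s.reg x = s.reg y
  | ne x y, s => s.reg x ≠ s.reg y

/-- Programs. -/
inductive Prog
  | skip
  | instr (i : Instr)
  | seq (p q : Prog)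
  | ite (b : Test) (p q : Prog)
  | while (b : Test) (p : Prog)

/-- `Exec W p s t s'`: on a machine whose words hold the numbers smaller than `W`, program `p`
started in state `s` halts in state `s'` after exactly `t` steps, and there is no overflow. -/
inductive Exec (W : ℕ) : Prog → State → ℕ → State → Prop
  | skip (s : State) : Exec W .skip s 1 s
  | instr (i : Instr) (s : State) : i.Fits W s → Exec W (.instr i) s 1 (i.run s)
  | seq {p q : Prog} {s s' s'' : State} {t t' : ℕ} :
      Exec W p s t s' → Exec W q s' t' s'' → Exec W (.seq p q) s (t + t') s''
  | ite_true {b : Test} {p q : Prog} {s s' : State} {t : ℕ} :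
      b.Holds s → Exec W p s t s' → Exec W (.ite b p q) s (t + 1) s'
  | ite_false {b : Test} {p q : Prog} {s s' : State} {t : ℕ} :
      ¬ b.Holds s → Exec W q s t s' → Exec W (.ite b p q) s (t + 1) s'
  | while_true {b : Test} {p : Prog} {s s' s'' : State} {t t' : ℕ} :
      b.Holds s → Exec W p s t s' → Exec W (.while b p) s' t' s'' →
      Exec W (.while b p) s (t + t' + 1) s''
  | while_false {b : Test} {p : Prog} {s : State} :
      ¬ b.Holds s → Exec W (.while b p) s 1 s

open Classical in
/-- The input: registers `0`, `1`, `2` hold `n`, `k` and the number `m` of listed vertices,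
array `0` holds the adjacency matrix of `T` row by row, array `1` holds the listed vertices, and
everything else is `0`. -/
noncomputable def inputState {n m : ℕ} (T : Digraph (Fin n)) (k : ℕ) (z : Fin m → Fin n) :
    State where
  reg x := if x = 0 then n else if x = 1 then k else if x = 2 then m else 0
  arr a i :=
    if a = 0 then (if ∃ u v : Fin n, T.Adj u v ∧ i = u * n + v then 1 else 0)
    else if a = 1 then (if h : i < m then (z ⟨i, h⟩ : ℕ) else 0)
    else 0

/-- The first `k` cells of array `a` list the vertices in `A`. -/
def State.Lists (s : State) (a k : ℕ) {n : ℕ} (A : Finset (Fin n)) : Prop :=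
  (Finset.range k).image (s.arr a) = A.image (fun v : Fin n => (v : ℕ))

end WordRAM

/-! ### Homogeneous subsequences -/

/-! Everything is read off from outdegrees. Let r and m be huge in terms of k. For a threshold d,
call a vertex low if its outdegree is at most d and high if it is at least d + 3r; the window
consists of the vertices with outdegree in [d, d + 3r). Take d least such that m jungle vertices are
low. Then the window has at least m vertices, or the arcs from low to high vertices have no cover by
fewer than m low and fewer than m high vertices: otherwise the window together with the cover would
separate two jungle vertices with order less than 3m (`IsJungle.exists_threshold`). In the second
case every maximal matching of low-to-high arcs has at least m arcs.

Both outcomes give a triple by Ramsey arguments, which meet in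
`IsSemicomplete.hasTripleIn_of_complete`. Suppose that all arcs from c_1, ..., c_r to a_1, ..., a_r
are present and that each a_i has 3r outneighbours that are not outneighbours of c_i. Then there are
distinct p_i with a_i → p_i → c_i. By `IsSemicomplete.matching_dichotomy`, each of the matchings a_i
p_i and p_i c_i gives a triple directly or a large half graph, and two half graphs on common indices
contain three blocks of size k that form a triple. For a low-to-high matching c_i → a_i, the
dichotomy gives the complete pair and the gap between the degrees gives the private outneighbours.
In a large window, Ramsey's theorem gives a complete digraph, which contains a triple, or a
transitive tournament. In the tournament, later vertices must have many private outneighbours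
against earlier ones, since otherwise the outdegrees would spread beyond the width of the window.

The algorithm tries every d < n; the jungle only guarantees that some d is good. For each d it lists
up to m window vertices and the ends of a greedy matching, at most 3m + 1 vertices in all, and adds
up to 3r vertices of N⁺(u) \ N⁺(v) for each ordered pair of listed vertices. The arguments above
never leave this set S (`IsClosure`), and |S| is bounded in terms of k. The function f is so large
that |S|^(3k) ≤ n and k² ≤ n, hence testing all 3k-tuples from S takes O(n²) steps, as does building
S. This gives O(n³) steps with an absolute constant. The running times and the absence of overflow
are proved along with correctness, in a Hoare-style logic (`Runs`). -/

theorem exists_endHomogeneous {κ : Type*} [Fintype κ] [DecidableEq κ] (hκ : 2 ≤ Fintype.card κ)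
    (c : ℕ → ℕ → κ) (t : ℕ) : ∀ S : Finset ℕ, Fintype.card κ ^ t ≤ S.card →
      ∃ R ⊆ S, R.card = t ∧ ∃ g : ℕ → κ, ∀ i ∈ R, ∀ j ∈ R, i < j → c i j = g i := by
  induction t with
  | zero => exact fun S _ => ⟨∅, by simp, rfl, fun i => c i i, by simp⟩
  | succ t ih =>
    intro S hS
    have hpos : 0 < Fintype.card κ ^ t := by positivity
    have hne : S.Nonempty := by
      rw [← Finset.card_pos]; exact lt_of_lt_of_le (by positivity) hS
    set s := S.min' hne with hs
    have hsS : s ∈ S := S.min'_mem hne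
    -- With q colours, at least q^(t+1) - 1 elements remain without `s`. As q ≥ 2, this exceeds q
    -- (q^t - 1), so some colour occurs on pairs with `s` at least q^t times.
    have hlt : (Finset.univ : Finset κ).card * (Fintype.card κ ^ t - 1) < (S.erase s).card := by
      rw [Finset.card_erase_of_mem hsS, Finset.card_univ, Nat.mul_sub, mul_one, ← pow_succ']
      have : Fintype.card κ ≤ Fintype.card κ ^ (t + 1) := Nat.le_self_pow (by omega) _
      omega
    obtain ⟨y, -, hy⟩ := Finset.exists_lt_card_fiber_of_mul_lt_card_of_maps_to
      (f := fun j => c s j) (fun _ _ => Finset.mem_univ _) hlt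
    obtain ⟨R, hR, hRc, g, hg⟩ := ih ((S.erase s).filter fun j => c s j = y) (by omega)
    have hR' : ∀ j ∈ R, j ∈ S ∧ s < j ∧ c s j = y := by
      intro j hj
      have h1 := hR hj
      simp only [Finset.mem_filter, Finset.mem_erase] at h1
      exact ⟨h1.1.2, lt_of_le_of_ne (S.min'_le _ h1.1.2) (Ne.symm h1.1.1), h1.2⟩
    have hsR : s ∉ R := fun h => lt_irrefl _ (hR' s h).2.1
    refine ⟨insert s R, ?_, ?_, Function.update g s y, ?_⟩
    · intro j hj
      rcases Finset.mem_insert.1 hj with rfl | hj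
      exacts [hsS, (hR' j hj).1]
    · rw [Finset.card_insert_of_notMem hsR, hRc]
    · intro i hi j hj hij
      rcases Finset.mem_insert.1 hi with hi | hi
      · subst hi
        rcases Finset.mem_insert.1 hj with hj | hj
        · exact absurd hij (by rw [hj]; exact lt_irrefl _)
        · simpa using (hR' j hj).2.2
      · have hne' : i ≠ s := fun h => hsR (h ▸ hi)
        rw [Function.update_of_ne hne']
        rcases Finset.mem_insert.1 hj with hj | hj
        · have := (hR' i hi).2.1
          omega
        · exact hg i hi j hj hij

/-- In an end-homogeneous set of size 16 r the colour of a pair depends only on its smaller index,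
and r indices share that colour. Four bits hold all the properties that are made uniform at once
later on. -/
theorem exists_homogeneous_seq (c : ℕ → ℕ → Bool × Bool × Bool × Bool) (r M : ℕ)
    (hM : 16 ^ (16 * r) ≤ M) :
    ∃ (φ : ℕ → ℕ) (x : Bool × Bool × Bool × Bool), (∀ i < r, φ i < M) ∧
      ∀ i j, i < j → j < r → φ i < φ j ∧ c (φ i) (φ j) = x := by
  have hq : Fintype.card (Bool × Bool × Bool × Bool) = 16 := rfl
  obtain ⟨R, hR, hRc, g, hg⟩ := exists_endHomogeneous (by omega) c (16 * r) (Finset.range M)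
    (by rwa [hq, Finset.card_range])
  obtain ⟨x, -, hx⟩ := Finset.exists_le_card_fiber_of_mul_le_card_of_maps_to (s := R)
    (t := (Finset.univ : Finset (Bool × Bool × Bool × Bool))) (f := g) (n := r)
    (fun _ _ => Finset.mem_univ _) Finset.univ_nonempty
    (by rw [Finset.card_univ, hq, hRc])
  obtain ⟨R', hR', hc'⟩ := Finset.exists_subset_card_eq hx
  have hmem : ∀ i : Fin r, R'.orderEmbOfFin hc' i ∈ R ∧ g (R'.orderEmbOfFin hc' i) = x := by
    intro i
    have := hR' (R'.orderEmbOfFin_mem hc' i)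
    simpa using this
  refine ⟨fun i => if h : i < r then R'.orderEmbOfFin hc' ⟨i, h⟩ else 0, x, ?_, ?_⟩
  · intro i hi
    simp only [hi, dif_pos]
    exact Finset.mem_range.1 (hR (hmem _).1)
  · intro i j hij hj
    have hi : i < r := hij.trans hj
    have hlt : R'.orderEmbOfFin hc' ⟨i, hi⟩ < R'.orderEmbOfFin hc' ⟨j, hj⟩ := by
      simpa using hij
    simp only [hi, hj, dif_pos]
    exact ⟨hlt, (hg _ (hmem _).1 _ (hmem _).1 hlt).trans (hmem _).2⟩

/-! ### Triples given by sequences -/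

namespace Digraph

/-- The first `k` terms of `a`, `b` and `c` are orderings of the parts of a `k`-triple
(in a digraph without loops). -/
structure IsTripleFamily {V : Type*} (T : Digraph V) (k : ℕ) (a b c : ℕ → V) : Prop where
  inj_a : ∀ i < k, ∀ j < k, a i = a j → i = j
  inj_b : ∀ i < k, ∀ j < k, b i = b j → i = j
  inj_c : ∀ i < k, ∀ j < k, c i = c j → i = j
  ne_ac : ∀ i < k, ∀ j < k, a i ≠ c j
  adj_ab : ∀ i < k, ∀ j < k, T.Adj (a i) (b j)
  adj_bc : ∀ i < k, ∀ j < k, T.Adj (b i) (c j)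
  adj_ca : ∀ i < k, T.Adj (c i) (a i)

/-- The set `S` contains a `k`-triple. -/
def HasTripleIn {V : Type*} (T : Digraph V) (k : ℕ) (S : Finset V) : Prop :=
  ∃ a b c : ℕ → V, T.IsTripleFamily k a b c ∧ ∀ i < k, a i ∈ S ∧ b i ∈ S ∧ c i ∈ S

/-- Arcs join distinct vertices, so complete adjacency already separates A from B and B from C. Only
matching arcs run from C to A, which is why `ne_ac` is a separate condition. -/
theorem IsTripleFamily.isTriple {V : Type*} [DecidableEq V] {T : Digraph V}
    (hT : T.IsSemicomplete) {k : ℕ} {a b c : ℕ → V} (h : T.IsTripleFamily k a b c) :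
    T.IsTriple k ((Finset.range k).image a) ((Finset.range k).image b)
      ((Finset.range k).image c) := by
  have hne : ∀ {x y}, T.Adj x y → x ≠ y := fun hxy e => hT.1 _ (e ▸ hxy)
  have hdisj : ∀ {p q : ℕ → V}, (∀ i < k, ∀ j < k, p i ≠ q j) →
      Disjoint ((Finset.range k).image p) ((Finset.range k).image q) := by
    intro p q hpq
    rw [Finset.disjoint_left]
    intro x hx hy
    simp only [Finset.mem_image, Finset.mem_range] at hx hy
    obtain ⟨i, hi, rfl⟩ := hx
    obtain ⟨j, hj, hj'⟩ := hy
    exact hpq i hi j hj hj'.symm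
  have hcard : ∀ {p : ℕ → V}, (∀ i < k, ∀ j < k, p i = p j → i = j) →
      ((Finset.range k).image p).card = k := by
    intro p hp
    rw [Finset.card_image_of_injOn, Finset.card_range]
    intro i hi j hj hij
    exact hp i (by simpa using hi) j (by simpa using hj) hij
  have hmap : ∀ {p : ℕ → V} (hp : ∀ i < k, ∀ j < k, p i = p j → i = j),
      Finset.univ.map (⟨fun i : Fin k => p i, fun i j e => Fin.ext (hp i i.2 j j.2 e)⟩ : Fin k ↪ V)
        = (Finset.range k).image p := by
    intro p hp
    ext x
    simp only [Finset.mem_map, Finset.mem_univ, true_and, Finset.mem_image, Finset.mem_range]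
    exact ⟨fun ⟨i, hi⟩ => ⟨i, i.2, hi⟩, fun ⟨i, hi, e⟩ => ⟨⟨i, hi⟩, e⟩⟩
  exact ⟨hdisj fun i hi j hj => hne (h.adj_ab i hi j hj),
    hdisj fun i hi j hj => hne (h.adj_bc i hi j hj), hdisj h.ne_ac, hcard h.inj_a, hcard h.inj_b,
    hcard h.inj_c, _, _, _, hmap h.inj_a, hmap h.inj_b, hmap h.inj_c,
    fun i j => h.adj_ab i i.2 j j.2, fun i j => h.adj_bc i i.2 j j.2, fun i => h.adj_ca i i.2⟩

/-! ### Triples from matchings and from complete pairs -/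

/-- From a large matching one gets a triple, or a half graph. -/
theorem IsSemicomplete.matching_dichotomy {V : Type*} {T : Digraph V} (hT : T.IsSemicomplete)
    {k r M : ℕ} (hk : 2 * k ≤ r) (hM : 16 ^ (16 * r) ≤ M) {S : Finset V} {u v : ℕ → V}
    (hu : ∀ i < M, ∀ j < M, u i = u j → i = j) (hv : ∀ i < M, ∀ j < M, v i = v j → i = j)
    (huv : ∀ i < M, ∀ j < M, u i ≠ v j) (hadj : ∀ i < M, T.Adj (u i) (v i))
    (hS : ∀ i < M, u i ∈ S ∧ v i ∈ S) :
    T.HasTripleIn k S ∨ ∃ φ : ℕ → ℕ, (∀ i < r, φ i < M) ∧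
      (∀ i j, i < j → j < r → φ i < φ j) ∧
      ((∀ i j, i < j → j < r → T.Adj (u (φ i)) (v (φ j))) ∨
        (∀ i j, i < j → j < r → T.Adj (u (φ j)) (v (φ i)))) := by
  classical
  -- The bits record the two kinds of arcs from heads back to tails and the arcs among tails; the
  -- last bit is a filler. If one kind of backward arc is missing, semicompleteness makes the
  -- matching extend to a half graph.
  obtain ⟨φ, ⟨x1, x2, x3, x4⟩, hφ, hx⟩ := exists_homogeneous_seq
    (fun i j => (decide (T.Adj (v j) (u i)), decide (T.Adj (v i) (u j)),
      decide (T.Adj (u i) (u j)), true)) r M hM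
  simp only [Prod.mk.injEq] at hx
  have hinj : ∀ i < r, ∀ j < r, φ i = φ j → i = j := by
    intro i hi j hj e
    rcases lt_trichotomy i j with h | h | h
    · have := (hx i j h hj).1; omega
    · exact h
    · have := (hx j i h hi).1; omega
  have hsc : ∀ i < M, ∀ j < M, ¬ T.Adj (v j) (u i) → T.Adj (u i) (v j) := fun i hi j hj h =>
    (hT.2 _ _ (huv i hi j hj)).resolve_right h
  cases x1 with
  | false =>
    refine Or.inr ⟨φ, hφ, fun i j h h' => (hx i j h h').1, Or.inl fun i j h h' => ?_⟩
    exact hsc _ (hφ i (h.trans h')) _ (hφ j h') (by simpa using (hx i j h h').2.1)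
  | true =>
  cases x2 with
  | false =>
    refine Or.inr ⟨φ, hφ, fun i j h h' => (hx i j h h').1, Or.inr fun i j h h' => ?_⟩
    exact hsc _ (hφ j h') _ (hφ i (h.trans h')) (by simpa using (hx i j h h').2.2.1)
  | true =>
    left
    have hback : ∀ i < r, ∀ j < r, i ≠ j → T.Adj (v (φ i)) (u (φ j)) := by
      intro i hi j hj hij
      rcases lt_or_gt_of_ne hij with h | h
      · simpa using (hx i j h hj).2.2.1
      · simpa using (hx j i h hi).2.1
    -- If all tails of block `o'` are joined to all tails of block `o`, the parts are the heads of
    -- `o`, the tails of `o'` and the tails of `o`. The matching itself supplies the arcs from the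
    -- third part to the first.
    have key : ∀ o o' : ℕ, o + k ≤ r → o' + k ≤ r → (∀ i < k, ∀ j < k, o + i ≠ o' + j) →
        (∀ i < k, ∀ j < k, T.Adj (u (φ (o' + i))) (u (φ (o + j)))) → T.HasTripleIn k S := by
      intro o o' ho ho' hne huu
      refine ⟨fun i => v (φ (o + i)), fun i => u (φ (o' + i)), fun i => u (φ (o + i)), ?_, ?_⟩
      · constructor
        · intro i hi j hj e
          have := hinj _ (by omega) _ (by omega) (hv _ (hφ _ (by omega)) _ (hφ _ (by omega)) e)
          omega
        · intro i hi j hj e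
          have := hinj _ (by omega) _ (by omega) (hu _ (hφ _ (by omega)) _ (hφ _ (by omega)) e)
          omega
        · intro i hi j hj e
          have := hinj _ (by omega) _ (by omega) (hu _ (hφ _ (by omega)) _ (hφ _ (by omega)) e)
          omega
        · exact fun i hi j hj => (huv _ (hφ _ (by omega)) _ (hφ _ (by omega))).symm
        · exact fun i hi j hj => hback _ (by omega) _ (by omega) (hne i hi j hj)
        · exact huu
        · exact fun i hi => hadj _ (hφ _ (by omega))
      · exact fun i hi => ⟨(hS _ (hφ _ (by omega))).2, (hS _ (hφ _ (by omega))).1,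
          (hS _ (hφ _ (by omega))).1⟩
    cases x3 with
    | true =>
      refine key k 0 (by omega) (by omega) (by omega) fun i hi j hj => ?_
      simpa using (hx (0 + i) (k + j) (by omega) (by omega)).2.2.2.1
    | false =>
      refine key 0 k (by omega) (by omega) (by omega) fun i hi j hj => ?_
      have h := (hx (0 + j) (k + i) (by omega) (by omega)).2.2.2.1
      refine (hT.2 _ _ fun e => ?_).resolve_right (by simpa using h)
      have := hinj _ (by omega) _ (by omega) (hu _ (hφ _ (by omega)) _ (hφ _ (by omega)) e)
      omega

open Classical in
/-- The set of outneighbours. -/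
noncomputable def outSet {V : Type*} [Fintype V] (T : Digraph V) (v : V) : Finset V :=
  Finset.univ.filter (T.Adj v)

@[simp] theorem mem_outSet {V : Type*} [Fintype V] {T : Digraph V} {v w : V} :
    w ∈ T.outSet v ↔ T.Adj v w := by simp [outSet]

/-- The outdegree. -/
noncomputable def outDeg {V : Type*} [Fintype V] (T : Digraph V) (v : V) : ℕ := (T.outSet v).card

/-- Each set retains at least r elements outside F, and a subfamily has at most r members, so Hall's
condition is immediate. -/
theorem exists_distinct_representatives {V : Type*} [DecidableEq V] (r : ℕ) (D : ℕ → Finset V)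
    (F : Finset V) (v₀ : V) (h : ∀ i < r, F.card + r ≤ (D i).card) :
    ∃ p : ℕ → V, (∀ i < r, p i ∈ D i ∧ p i ∉ F) ∧ ∀ i < r, ∀ j < r, p i = p j → i = j := by
  have hall : ∀ s : Finset (Fin r), s.card ≤ (s.biUnion fun i => D i \ F).card := by
    intro s
    rcases s.eq_empty_or_nonempty with rfl | ⟨i, hi⟩
    · simp
    · have h1 : s.card ≤ r := by simpa using s.card_le_univ
      have h2 : (D i \ F).card ≤ (s.biUnion fun i => D i \ F).card :=
        Finset.card_le_card (Finset.subset_biUnion_of_mem (fun i : Fin r => D i \ F) hi)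
      have h3 := Finset.le_card_sdiff F (D i)
      have h4 := h i i.2
      omega
  obtain ⟨p, hp, hpD⟩ := (Finset.all_card_le_biUnion_card_iff_exists_injective _).1 hall
  refine ⟨fun i => if hi : i < r then p ⟨i, hi⟩ else v₀, ?_, ?_⟩
  · intro i hi
    simpa [hi] using hpD ⟨i, hi⟩
  · intro i hi j hj e
    simp only [hi, hj, dif_pos] at e
    simpa using hp e

/-- Two large sets with all arcs from the second to the first, and many paths of length two back. -/
theorem IsSemicomplete.hasTripleIn_of_complete {V : Type*} [Fintype V] [DecidableEq V]
    {T : Digraph V} (hT : T.IsSemicomplete) {k r₁ r : ℕ} (hk : 1 ≤ k)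
    (hr₁ : 16 ^ (16 * (3 * k)) ≤ r₁) (hr : 16 ^ (16 * r₁) ≤ r) {S : Finset V} {a c : ℕ → V}
    (ha : ∀ i < r, ∀ j < r, a i = a j → i = j) (hc : ∀ i < r, ∀ j < r, c i = c j → i = j)
    (hca : ∀ i < r, ∀ j < r, T.Adj (c i) (a j)) (hS : ∀ i < r, a i ∈ S ∧ c i ∈ S)
    (hD : ∀ i < r, 3 * r ≤ (S ∩ (T.outSet (a i) \ T.outSet (c i))).card) :
    T.HasTripleIn k S := by
  have hle : ∀ x : ℕ, x ≤ 16 ^ (16 * x) := fun x =>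
    (Nat.lt_pow_self (by norm_num : 1 < 16)).le.trans (Nat.pow_le_pow_right (by norm_num) (by omega))
  have h3k : 3 * k ≤ r₁ := (hle _).trans hr₁
  -- The representatives must avoid these at most 2r vertices. Being different from c_i, p_i then
  -- sends an arc to c_i, because c_i sends none to p_i. The bound 3r in `hD` leaves r choices.
  set F := (Finset.range r).image a ∪ (Finset.range r).image c with hF
  have hFc : F.card ≤ 2 * r := by
    refine (Finset.card_union_le _ _).trans ?_
    have h1 := Finset.card_image_le (s := Finset.range r) (f := a)
    have h2 := Finset.card_image_le (s := Finset.range r) (f := c)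
    rw [Finset.card_range] at h1 h2
    omega
  obtain ⟨p, hp, hpinj⟩ := exists_distinct_representatives r
    (fun i => S ∩ (T.outSet (a i) \ T.outSet (c i))) F (a 0) (fun i hi => by
      have := hD i hi; omega)
  have hpF : ∀ i < r, (∀ j < r, a j ≠ p i) ∧ ∀ j < r, p i ≠ c j := by
    intro i hi
    have h := (hp i hi).2
    rw [hF, Finset.mem_union, not_or] at h
    refine ⟨fun j hj e => h.1 ?_, fun j hj e => h.2 ?_⟩
    · exact Finset.mem_image.2 ⟨j, Finset.mem_range.2 hj, e⟩
    · exact Finset.mem_image.2 ⟨j, Finset.mem_range.2 hj, e.symm⟩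
  have hpD : ∀ i < r, p i ∈ S ∧ T.Adj (a i) (p i) ∧ T.Adj (p i) (c i) := by
    intro i hi
    have h := (hp i hi).1
    simp only [Finset.mem_inter, Finset.mem_sdiff, mem_outSet] at h
    exact ⟨h.1, h.2.1, (hT.2 _ _ ((hpF i hi).2 i hi)).resolve_right h.2.2⟩
  rcases hT.matching_dichotomy (k := k) (S := S) (by omega) hr ha hpinj
    (fun i hi j hj => (hpF j hj).1 i hi) (fun i hi => (hpD i hi).2.1)
    (fun i hi => ⟨(hS i hi).1, (hpD i hi).1⟩) with h | ⟨φ, hφ, hφm, hap⟩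
  · exact h
  have hφinj : ∀ i < r₁, ∀ j < r₁, φ i = φ j → i = j := by
    intro i hi j hj e
    rcases lt_trichotomy i j with h | h | h
    · have := hφm i j h hj; omega
    · exact h
    · have := hφm j i h hi; omega
  rcases hT.matching_dichotomy (k := k) (S := S) (r := 3 * k) (M := r₁) (u := fun i => p (φ i))
    (v := fun i => c (φ i)) (by omega) hr₁
    (fun i hi j hj e => hφinj i hi j hj (hpinj _ (hφ i hi) _ (hφ j hj) e))
    (fun i hi j hj e => hφinj i hi j hj (hc _ (hφ i hi) _ (hφ j hj) e))
    (fun i hi j hj => (hpF _ (hφ i hi)).2 _ (hφ j hj)) (fun i hi => (hpD _ (hφ i hi)).2.2)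
    (fun i hi => ⟨(hpD _ (hφ i hi)).1, (hS _ (hφ i hi)).2⟩) with h | ⟨ψ, hψ, hψm, hpc⟩
  · exact h
  have hψinj : ∀ i < 3 * k, ∀ j < 3 * k, φ (ψ i) = φ (ψ j) → i = j := by
    intro i hi j hj e
    have e' := hφinj _ (hψ i hi) _ (hψ j hj) e
    rcases lt_trichotomy i j with h | h | h
    · have := hψm i j h hj; omega
    · exact h
    · have := hψm j i h hi; omega
  have hlt : ∀ i < 3 * k, φ (ψ i) < r := fun i hi => hφ _ (hψ i hi)
  -- The p's always take the middle one of three index blocks. The block of the a's is the first or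
  -- the last according to the direction of the half graph, and likewise for the c's.
  obtain ⟨o, ho, hop⟩ : ∃ o, o + k ≤ 3 * k ∧
      ∀ i < k, ∀ j < k, T.Adj (a (φ (ψ (o + i)))) (p (φ (ψ (k + j)))) := by
    rcases hap with h | h
    · exact ⟨0, by omega, fun i hi j hj =>
        h _ _ (hψm _ _ (by omega) (by omega)) (hψ _ (by omega))⟩
    · exact ⟨2 * k, by omega, fun i hi j hj =>
        h _ _ (hψm _ _ (by omega) (by omega)) (hψ _ (by omega))⟩
  obtain ⟨o', ho', hop'⟩ : ∃ o', o' + k ≤ 3 * k ∧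
      ∀ i < k, ∀ j < k, T.Adj (p (φ (ψ (k + i)))) (c (φ (ψ (o' + j)))) := by
    rcases hpc with h | h
    · exact ⟨2 * k, by omega, fun i hi j hj => h _ _ (by omega) (by omega)⟩
    · exact ⟨0, by omega, fun i hi j hj => h _ _ (by omega) (by omega)⟩
  refine ⟨fun i => a (φ (ψ (o + i))), fun i => p (φ (ψ (k + i))), fun i => c (φ (ψ (o' + i))),
    ?_, ?_⟩
  · constructor
    · intro i hi j hj e
      have := hψinj _ (by omega) _ (by omega) (ha _ (hlt _ (by omega)) _ (hlt _ (by omega)) e)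
      omega
    · intro i hi j hj e
      have := hψinj _ (by omega) _ (by omega) (hpinj _ (hlt _ (by omega)) _ (hlt _ (by omega)) e)
      omega
    · intro i hi j hj e
      have := hψinj _ (by omega) _ (by omega) (hc _ (hlt _ (by omega)) _ (hlt _ (by omega)) e)
      omega
    · intro i hi j hj e
      have h := hca _ (hlt (o' + j) (by omega)) _ (hlt (o + i) (by omega))
      rw [← e] at h
      exact hT.1 _ h
    · exact hop
    · exact hop'
    · exact fun i hi => hca _ (hlt _ (by omega)) _ (hlt _ (by omega))
  · exact fun i hi => ⟨(hS _ (hlt _ (by omega))).1, (hpD _ (hlt _ (by omega))).1,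
      (hS _ (hlt _ (by omega))).2⟩

/-! ### Triples from outdegrees -/

/-- The set `S` contains `X` and, for all `u` and `v` in `X`, at least `N` of the vertices that
are outneighbours of `u` but not of `v` (all of them, if there are fewer than `N`). -/
def IsClosure {V : Type*} [Fintype V] [DecidableEq V] (T : Digraph V) (N : ℕ)
    (X S : Finset V) : Prop :=
  X ⊆ S ∧ ∀ u ∈ X, ∀ v ∈ X,
    min N (T.outSet u \ T.outSet v).card ≤ (S ∩ (T.outSet u \ T.outSet v)).card

/-- A large matching whose heads have larger outdegrees than its tails. -/
theorem IsSemicomplete.hasTripleIn_of_matching {V : Type*} [Fintype V] [DecidableEq V]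
    {T : Digraph V} (hT : T.IsSemicomplete) {k r₁ r m d : ℕ} (hk : 1 ≤ k)
    (hr₁ : 16 ^ (16 * (3 * k)) ≤ r₁) (hr : 16 ^ (16 * r₁) ≤ r) (hm : 16 ^ (16 * (2 * r)) ≤ m)
    {X S : Finset V} (hXS : T.IsClosure (3 * r) X S) {c a : ℕ → V}
    (hc : ∀ i < m, ∀ j < m, c i = c j → i = j) (ha : ∀ i < m, ∀ j < m, a i = a j → i = j)
    (hca : ∀ i < m, T.Adj (c i) (a i)) (hX : ∀ i < m, c i ∈ X ∧ a i ∈ X)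
    (hdc : ∀ i < m, T.outDeg (c i) ≤ d) (hda : ∀ i < m, d + 3 * r ≤ T.outDeg (a i)) :
    T.HasTripleIn k S := by
  have hle : ∀ x : ℕ, x ≤ 16 ^ (16 * x) := fun x =>
    (Nat.lt_pow_self (by norm_num : 1 < 16)).le.trans (Nat.pow_le_pow_right (by norm_num) (by omega))
  have h3k : 3 * k ≤ r := ((hle _).trans hr₁).trans ((hle _).trans hr)
  rcases hT.matching_dichotomy (k := k) (S := S) (r := 2 * r) (by omega) hm hc ha
    (fun i hi j hj e => by
      have h1 := hdc i hi
      have h2 := hda j hj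
      rw [e] at h1
      omega) hca (fun i hi => ⟨hXS.1 (hX i hi).1, hXS.1 (hX i hi).2⟩) with h | ⟨φ, hφ, hφm, h⟩
  · exact h
  have hφinj : ∀ i < 2 * r, ∀ j < 2 * r, φ i = φ j → i = j := by
    intro i hi j hj e
    rcases lt_trichotomy i j with h | h | h
    · have := hφm i j h hj; omega
    · exact h
    · have := hφm j i h hi; omega
  -- A half graph on 2r indices contains a complete pair between its first r and its last r indices.
  have key : ∀ o o' : ℕ, o + r ≤ 2 * r → o' + r ≤ 2 * r →
      (∀ i < r, ∀ j < r, T.Adj (c (φ (o + i))) (a (φ (o' + j)))) → T.HasTripleIn k S := by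
    intro o o' ho ho' hadj
    refine hT.hasTripleIn_of_complete (a := fun i => a (φ (o' + i))) (c := fun i => c (φ (o + i)))
      hk hr₁ hr ?_ ?_ hadj ?_ ?_
    · intro i hi j hj e
      have := hφinj _ (by omega) _ (by omega) (ha _ (hφ _ (by omega)) _ (hφ _ (by omega)) e)
      omega
    · intro i hi j hj e
      have := hφinj _ (by omega) _ (by omega) (hc _ (hφ _ (by omega)) _ (hφ _ (by omega)) e)
      omega
    · exact fun i hi => ⟨hXS.1 (hX _ (hφ _ (by omega))).2, hXS.1 (hX _ (hφ _ (by omega))).1⟩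
    · intro i hi
      have h1 := hXS.2 _ (hX _ (hφ (o' + i) (by omega))).2 _ (hX _ (hφ (o + i) (by omega))).1
      have h2 := hda _ (hφ (o' + i) (by omega))
      have h3 := hdc _ (hφ (o + i) (by omega))
      -- The degree gap of 3r forces 3r private outneighbours, and the closure keeps that many of
      -- them in S.
      have h4 := Finset.le_card_sdiff (T.outSet (c (φ (o + i)))) (T.outSet (a (φ (o' + i))))
      simp only [outDeg] at h2 h3
      exact (le_min le_rfl (by omega)).trans h1
  rcases h with h | h
  · exact key 0 r (by omega) (by omega) fun i hi j hj => h _ _ (by omega) (by omega)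
  · exact key r 0 (by omega) (by omega) fun i hi j hj => h _ _ (by omega) (by omega)

/-- A large transitive tournament whose vertices have similar outdegrees. -/
theorem IsSemicomplete.hasTripleIn_of_transitive {V : Type*} [Fintype V] [DecidableEq V]
    {T : Digraph V} (hT : T.IsSemicomplete) {k r₁ r d : ℕ} (hk : 1 ≤ k)
    (hr₁ : 16 ^ (16 * (3 * k)) ≤ r₁) (hr : 16 ^ (16 * r₁) ≤ r)
    {X S : Finset V} (hXS : T.IsClosure (3 * r) X S) {y : ℕ → V}
    (hy : ∀ i < 7 * r, ∀ j < 7 * r, y i = y j → i = j) (hX : ∀ i < 7 * r, y i ∈ X)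
    (hd : ∀ i < 7 * r, d ≤ T.outDeg (y i) ∧ T.outDeg (y i) < d + 3 * r)
    (hadj : ∀ i j, i < j → j < 7 * r → T.Adj (y i) (y j) ∧ ¬ T.Adj (y j) (y i))
    (h : (∀ i j, i < j → j < 7 * r → 3 * r ≤ (T.outSet (y j) \ T.outSet (y i)).card) ∨
      ∀ i j, i < j → j < 7 * r → ¬ 3 * r ≤ (T.outSet (y j) \ T.outSet (y i)).card) :
    T.HasTripleIn k S := by
  rcases h with h | h
  · refine hT.hasTripleIn_of_complete (a := fun i => y (r + i)) (c := y) hk hr₁ hr ?_ ?_ ?_ ?_ ?_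
    · intro i hi j hj e
      have := hy _ (by omega) _ (by omega) e
      omega
    · exact fun i hi j hj e => hy _ (by omega) _ (by omega) e
    · exact fun i hi j hj => (hadj _ _ (by omega) (by omega)).1
    · exact fun i hi => ⟨hXS.1 (hX _ (by omega)), hXS.1 (hX _ (by omega))⟩
    · intro i hi
      have h1 := hXS.2 _ (hX (r + i) (by omega)) _ (hX i (by omega))
      exact (le_min le_rfl (h _ _ (by omega) (by omega))).trans h1
  · exfalso
    have hrpos : 1 ≤ r := le_trans Nat.one_le_two_pow
      ((Nat.pow_le_pow_left (by norm_num : 2 ≤ 16) _).trans hr)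
    have h1 := h 0 (7 * r - 1) (by omega) (by omega)
    -- The 7r - 2 inner vertices are outneighbours of the first vertex but not of the last one.
    -- Fewer than 3r vertices count the other way, so the two outdegrees differ by at least 4r - 1 ≥
    -- 3r, which the window forbids.
    have h2 : (Finset.Ioo 0 (7 * r - 1)).image y ⊆ T.outSet (y 0) \ T.outSet (y (7 * r - 1)) := by
      intro x hx
      obtain ⟨i, hi, rfl⟩ := Finset.mem_image.1 hx
      rw [Finset.mem_Ioo] at hi
      simp only [Finset.mem_sdiff, mem_outSet]
      exact ⟨(hadj _ _ (by omega) (by omega)).1, (hadj _ _ (by omega) (by omega)).2⟩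
    have h3 := Finset.card_le_card h2
    rw [Finset.card_image_of_injOn, Nat.card_Ioo] at h3
    · have e1 := Finset.card_sdiff_add_card_inter (T.outSet (y 0)) (T.outSet (y (7 * r - 1)))
      have e2 := Finset.card_sdiff_add_card_inter (T.outSet (y (7 * r - 1))) (T.outSet (y 0))
      rw [Finset.inter_comm] at e2
      have d1 := hd 0 (by omega)
      have d2 := hd (7 * r - 1) (by omega)
      simp only [outDeg] at d1 d2
      omega
    · intro i hi j hj e
      simp only [Finset.coe_Ioo, Set.mem_Ioo] at hi hj
      exact hy _ (by omega) _ (by omega) e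

/-- A large set of vertices with similar outdegrees. -/
theorem IsSemicomplete.hasTripleIn_of_window {V : Type*} [Fintype V] [DecidableEq V]
    {T : Digraph V} (hT : T.IsSemicomplete) {k r₁ r m d : ℕ} (hk : 1 ≤ k)
    (hr₁ : 16 ^ (16 * (3 * k)) ≤ r₁) (hr : 16 ^ (16 * r₁) ≤ r) (hm : 16 ^ (16 * (7 * r)) ≤ m)
    {X S : Finset V} (hXS : T.IsClosure (3 * r) X S)
    (hX : m ≤ (X.filter fun v => d ≤ T.outDeg v ∧ T.outDeg v < d + 3 * r).card) :
    T.HasTripleIn k S := by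
  classical
  have hle : ∀ x : ℕ, x ≤ 16 ^ (16 * x) := fun x =>
    (Nat.lt_pow_self (by norm_num : 1 < 16)).le.trans (Nat.pow_le_pow_right (by norm_num) (by omega))
  have h3k : 3 * k ≤ r := ((hle _).trans hr₁).trans ((hle _).trans hr)
  obtain ⟨Y, hY, hYc⟩ := Finset.exists_subset_card_eq hX
  have hmpos : 0 < m := lt_of_lt_of_le (by positivity) hm
  let x : ℕ → V := fun i => if h : i < m then (Y.equivFinOfCardEq hYc).symm ⟨i, h⟩ else
    (Y.equivFinOfCardEq hYc).symm ⟨0, hmpos⟩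
  have hxY : ∀ i, x i ∈ X ∧ d ≤ T.outDeg (x i) ∧ T.outDeg (x i) < d + 3 * r := by
    intro i
    have : x i ∈ Y := by
      simp only [x]; split <;> exact Finset.coe_mem _
    simpa using hY this
  have hxinj : ∀ i < m, ∀ j < m, x i = x j → i = j := by
    intro i hi j hj e
    simp only [x, hi, hj, dif_pos] at e
    simpa using (Y.equivFinOfCardEq hYc).symm.injective (Subtype.ext e)
  -- The first two bits give the arcs in both directions; the other two tell whether either vertex
  -- has 3r private outneighbours against the other.
  obtain ⟨φ, ⟨x1, x2, x3, x4⟩, hφ, hx⟩ := exists_homogeneous_seq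
    (fun i j => (decide (T.Adj (x i) (x j)), decide (T.Adj (x j) (x i)),
      decide (3 * r ≤ (T.outSet (x j) \ T.outSet (x i)).card),
      decide (3 * r ≤ (T.outSet (x i) \ T.outSet (x j)).card))) (7 * r) m hm
  simp only [Prod.mk.injEq] at hx
  have hinj : ∀ i < 7 * r, ∀ j < 7 * r, x (φ i) = x (φ j) → i = j := by
    intro i hi j hj e
    have e' := hxinj _ (hφ i hi) _ (hφ j hj) e
    rcases lt_trichotomy i j with h | h | h
    · have := (hx i j h hj).1; omega
    · exact h
    · have := (hx j i h hi).1; omega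
  cases x1 with
  | false =>
    have hna : ∀ i j, i < j → j < 7 * r → ¬ T.Adj (x (φ i)) (x (φ j)) := fun i j hij hj => by
      simpa using (hx i j hij hj).2.1
    have hab : ∀ i j, i < j → j < 7 * r → T.Adj (x (φ j)) (x (φ i)) := fun i j hij hj =>
      (hT.2 _ _ fun e => hij.ne' (hinj _ hj _ (hij.trans hj) e)).resolve_right (hna i j hij hj)
    -- All arcs go from larger to smaller indices, so the sequence is reversed; this exchanges the
    -- roles of the last two bits.
    refine hT.hasTripleIn_of_transitive (y := fun i => x (φ (7 * r - 1 - i))) (d := d) hk hr₁ hr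
      hXS ?_ (fun i _ => (hxY _).1) (fun i _ => (hxY _).2) ?_ ?_
    · intro i hi j hj e
      have := hinj _ (by omega) _ (by omega) e
      omega
    · exact fun i j hij hj => ⟨hab _ _ (by omega) (by omega), hna _ _ (by omega) (by omega)⟩
    · cases x4 with
      | true =>
        exact Or.inl fun i j hij hj => by
          simpa using (hx (7 * r - 1 - j) (7 * r - 1 - i) (by omega) (by omega)).2.2.2.2
      | false =>
        exact Or.inr fun i j hij hj => by
          simpa using (hx (7 * r - 1 - j) (7 * r - 1 - i) (by omega) (by omega)).2.2.2.2
  | true =>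
  have hab : ∀ i j, i < j → j < 7 * r → T.Adj (x (φ i)) (x (φ j)) := fun i j hij hj => by
    simpa using (hx i j hij hj).2.1
  cases x2 with
  | false =>
    refine hT.hasTripleIn_of_transitive (y := fun i => x (φ i)) (d := d) hk hr₁ hr
      hXS hinj (fun i _ => (hxY _).1) (fun i _ => (hxY _).2) ?_ ?_
    · exact fun i j hij hj => ⟨hab _ _ hij hj, by simpa using (hx i j hij hj).2.2.1⟩
    · cases x3 with
      | true => exact Or.inl fun i j hij hj => by simpa using (hx i j hij hj).2.2.2.1
      | false => exact Or.inr fun i j hij hj => by simpa using (hx i j hij hj).2.2.2.1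
  | true =>
    have hba : ∀ i j, i < j → j < 7 * r → T.Adj (x (φ j)) (x (φ i)) := fun i j hij hj => by
      simpa using (hx i j hij hj).2.2.1
    -- All arcs are present in both directions, so any three disjoint blocks form a triple.
    refine ⟨fun i => x (φ i), fun i => x (φ (k + i)), fun i => x (φ (2 * k + i)), ?_, fun i _ =>
      ⟨hXS.1 (hxY _).1, hXS.1 (hxY _).1, hXS.1 (hxY _).1⟩⟩
    constructor
    · exact fun i hi j hj e => hinj _ (by omega) _ (by omega) e
    · intro i hi j hj e
      have := hinj _ (by omega) _ (by omega) e
      omega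
    · intro i hi j hj e
      have := hinj _ (by omega) _ (by omega) e
      omega
    · intro i hi j hj e
      have := hinj _ (by omega) _ (by omega) e
      omega
    · exact fun i hi j hj => hab _ _ (by omega) (by omega)
    · exact fun i hi j hj => hab _ _ (by omega) (by omega)
    · exact fun i hi => hba _ _ (by omega) (by omega)

/-! ### A threshold from the jungle -/

/-- In the presence of a jungle, some threshold `d` has a large window of outdegrees, or the arcs
from the vertices below the window to the vertices above it have no small cover. -/
theorem IsJungle.exists_threshold {V : Type*} [Fintype V] [DecidableEq V] {T : Digraph V}
    {f m l : ℕ} {Z : Finset V} (hZ : T.IsJungle f Z) (hm : 1 ≤ m) (hf : 3 * m ≤ f) (hl : 1 ≤ l)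
    (hT : T.IsSemicomplete) :
    ∃ d < Fintype.card V,
      m ≤ (Finset.univ.filter fun v => d ≤ T.outDeg v ∧ T.outDeg v < d + l).card ∨
      ∀ C D : Finset V, C.card < m → D.card < m →
        (∀ v ∈ C, T.outDeg v ≤ d) → (∀ v ∈ D, d + l ≤ T.outDeg v) →
        ∃ u v, T.Adj u v ∧ T.outDeg u ≤ d ∧ d + l ≤ T.outDeg v ∧ u ∉ C ∧ v ∉ D := by
  have hex : ∃ d, m ≤ (Z.filter fun v => T.outDeg v ≤ d).card := by
    refine ⟨Fintype.card V, ?_⟩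
    rw [Finset.filter_true_of_mem fun v _ =>
      show T.outDeg v ≤ _ from Finset.card_le_univ _, hZ.1]
    omega
  classical
  -- By minimality fewer than m jungle vertices have outdegree below d. If the window is small too,
  -- at least m jungle vertices lie above it.
  set d := Nat.find hex with hd
  have hd1 : m ≤ (Z.filter fun v => T.outDeg v ≤ d).card := Nat.find_spec hex
  have hd2 : (Z.filter fun v => T.outDeg v < d).card < m := by
    rcases Nat.eq_zero_or_pos d with h | h
    · simp only [h, Nat.not_lt_zero, Finset.filter_false, Finset.card_empty]; omega
    · have := Nat.find_min hex (show d - 1 < Nat.find hex by omega)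
      rw [not_le] at this
      refine lt_of_le_of_lt (Finset.card_le_card ?_) this
      exact Finset.monotone_filter_right _ fun v hv h' => by omega
  have hdn : d < Fintype.card V := by
    have hlt : ∀ v, T.outDeg v < Fintype.card V := fun v => by
      refine Finset.card_lt_univ_of_notMem (x := v) ?_
      rw [mem_outSet]
      exact hT.1 v
    by_contra hcon
    have : Z.filter (fun v => T.outDeg v < d) = Z :=
      Finset.filter_true_of_mem fun v _ => (hlt v).trans_le (not_lt.1 hcon)
    rw [this, hZ.1] at hd2
    omega
  refine ⟨d, hdn, ?_⟩
  by_contra hcon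
  push Not at hcon
  obtain ⟨hW, C, D, hC, hD, hCd, hDd, hcov⟩ := hcon
  have hH : m ≤ (Z.filter fun v => d + l ≤ T.outDeg v).card := by
    have h1 : Z ⊆ (Z.filter fun v => T.outDeg v < d) ∪
        ((Finset.univ.filter fun v => d ≤ T.outDeg v ∧ T.outDeg v < d + l) ∪
          Z.filter fun v => d + l ≤ T.outDeg v) := by
      intro v hv
      simp only [Finset.mem_union, Finset.mem_filter, hv, Finset.mem_univ, true_and]
      omega
    have h2 := (Finset.card_le_card h1).trans (Finset.card_union_le _ _)
    have h3 := Finset.card_union_le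
      (Finset.univ.filter fun v => d ≤ T.outDeg v ∧ T.outDeg v < d + l)
      (Z.filter fun v => d + l ≤ T.outDeg v)
    rw [hZ.1] at h2
    omega
  obtain ⟨x, hxZ, hxC⟩ : ∃ x ∈ Z.filter fun v => T.outDeg v ≤ d, x ∉ C :=
    Finset.exists_mem_notMem_of_card_lt_card (by omega)
  obtain ⟨y, hyZ, hyD⟩ : ∃ y ∈ Z.filter fun v => d + l ≤ T.outDeg v, y ∉ D :=
    Finset.exists_mem_notMem_of_card_lt_card (by omega)
  rw [Finset.mem_filter] at hxZ hyZ
  -- As l ≥ 1, A \ B consists of the vertices of outdegree at most d outside C, and B \ A of those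
  -- of outdegree at least d + l outside D. The intersection lies in the window together with C and
  -- D, so it has fewer than 3m ≤ f vertices.
  set A := Finset.univ.filter (fun v => T.outDeg v < d + l) ∪ D with hA
  set B := Finset.univ.filter (fun v => d < T.outDeg v) ∪ C with hB
  refine hZ.2 x hxZ.1 y hyZ.1 ⟨(A ∩ B).card, ?_, A, B, ⟨?_, le_rfl, ?_⟩, ?_, ?_⟩
  · have h1 : A ∩ B ⊆ (Finset.univ.filter fun v => d ≤ T.outDeg v ∧ T.outDeg v < d + l) ∪
        (C ∪ D) := by
      intro v hv
      simp only [hA, hB, Finset.mem_inter, Finset.mem_union, Finset.mem_filter, Finset.mem_univ,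
        true_and] at hv ⊢
      by_cases h1 : v ∈ C
      · exact Or.inr (Or.inl h1)
      by_cases h2 : v ∈ D
      · exact Or.inr (Or.inr h2)
      simp only [h1, h2, or_false] at hv ⊢
      omega
    have h2 := (Finset.card_le_card h1).trans (Finset.card_union_le _ _)
    have h3 := Finset.card_union_le C D
    omega
  · ext v
    simp only [hA, hB, Finset.mem_union, Finset.mem_filter, Finset.mem_univ, true_and, iff_true]
    omega
  · intro a ha b hb hab
    simp only [hA, hB, Finset.mem_sdiff, Finset.mem_union, Finset.mem_filter, Finset.mem_univ,
      true_and, not_or, not_lt] at ha hb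
    exact hb.2.2 (hcov a b hab ha.2.1 hb.2.1 ha.2.2)
  · simp only [hA, hB, Finset.mem_sdiff, Finset.mem_union, Finset.mem_filter, Finset.mem_univ,
      true_and, not_or, not_lt]
    exact ⟨Or.inl (by omega), hxZ.2, hxC⟩
  · simp only [hA, hB, Finset.mem_sdiff, Finset.mem_union, Finset.mem_filter, Finset.mem_univ,
      true_and, not_or, not_lt]
    exact ⟨Or.inl (by omega), hyZ.2, hyD⟩

end Digraph

/-! ### Reasoning about programs -/

namespace WordRAM

/-- Program `P` started in state `s` halts after at most `T` steps in a state satisfying `Q`. -/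
def Runs (W : ℕ) (P : Prog) (s : State) (T : ℕ) (Q : State → Prop) : Prop :=
  ∃ t s', Exec W P s t s' ∧ t ≤ T ∧ Q s'

/-- The register that the instruction writes. -/
def Instr.writesReg : Instr → ℕ → Bool
  | const x _, r => x == r
  | copy x _, r => x == r
  | arith _ x _ _, r => x == r
  | load x _ _, r => x == r
  | store _ _ _, _ => false

/-- The array that the instruction writes. -/
def Instr.writesArr : Instr → ℕ → Bool
  | store a _ _, b => a == b
  | _, _ => false

/-- Whether the program contains an instruction that writes the given register. -/
def Prog.writesReg : Prog → ℕ → Bool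
  | skip, _ => false
  | instr i, r => i.writesReg r
  | seq p q, r => p.writesReg r || q.writesReg r
  | ite _ p q, r => p.writesReg r || q.writesReg r
  | .while _ p, r => p.writesReg r

/-- Whether the program contains an instruction that writes the given array. -/
def Prog.writesArr : Prog → ℕ → Bool
  | skip, _ => false
  | instr i, r => i.writesArr r
  | seq p q, r => p.writesArr r || q.writesArr r
  | ite _ p q, r => p.writesArr r || q.writesArr r
  | .while _ p, r => p.writesArr r

/-- The states agree except for the registers and arrays that the program writes. -/
def Frame (P : Prog) (s s' : State) : Prop :=
  (∀ r, P.writesReg r = false → s'.reg r = s.reg r) ∧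
    ∀ a, P.writesArr a = false → s'.arr a = s.arr a

theorem Frame.refl (P : Prog) (s : State) : Frame P s s := ⟨fun _ _ => rfl, fun _ _ => rfl⟩

theorem Frame.trans {P : Prog} {s s' s'' : State} (h : Frame P s s') (h' : Frame P s' s'') :
    Frame P s s'' :=
  ⟨fun r hr => (h'.1 r hr).trans (h.1 r hr), fun a ha => (h'.2 a ha).trans (h.2 a ha)⟩

theorem Frame.mono {P Q : Prog} {s s' : State} (h : Frame P s s')
    (hr : ∀ r, Q.writesReg r = false → P.writesReg r = false)
    (ha : ∀ a, Q.writesArr a = false → P.writesArr a = false) : Frame Q s s' :=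
  ⟨fun r h' => h.1 r (hr r h'), fun a h' => h.2 a (ha a h')⟩

theorem Exec.frame {W : ℕ} {P : Prog} {s s' : State} {t : ℕ} (h : Exec W P s t s') :
    Frame P s s' := by
  induction h with
  | skip s => exact Frame.refl _ _
  | instr i s _ =>
    constructor
    · intro r hr
      cases i <;> simp only [Prog.writesReg, Instr.writesReg, beq_eq_false_iff_ne] at hr <;>
        first | rfl | exact Function.update_of_ne hr.symm _ _
    · intro r hr
      cases i <;> simp only [Prog.writesArr, Instr.writesArr, beq_eq_false_iff_ne] at hr <;>
        first | rfl | exact Function.update_of_ne hr.symm _ _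
  | seq _ _ h1 h2 =>
    exact (h1.mono (by simp +contextual [Prog.writesReg])
      (by simp +contextual [Prog.writesArr])).trans
      (h2.mono (by simp +contextual [Prog.writesReg]) (by simp +contextual [Prog.writesArr]))
  | ite_true _ _ h1 =>
    exact h1.mono (by simp +contextual [Prog.writesReg]) (by simp +contextual [Prog.writesArr])
  | ite_false _ _ h1 =>
    exact h1.mono (by simp +contextual [Prog.writesReg]) (by simp +contextual [Prog.writesArr])
  | while_true _ _ _ h1 h2 => exact Frame.trans (h1.mono (fun _ h => h) (fun _ h => h)) h2
  | while_false _ => exact Frame.refl _ _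

/-- Here and in `Runs.seq` the frame is passed on to whatever follows, so postconditions mention
only what a program changes. That a register or an array is preserved is then a computation, settled
by `rfl`. -/
theorem Runs.mono {W : ℕ} {P : Prog} {s : State} {T T' : ℕ} {Q Q' : State → Prop}
    (h : Runs W P s T Q) (hT : T ≤ T') (hQ : ∀ s', Frame P s s' → Q s' → Q' s') :
    Runs W P s T' Q' := by
  obtain ⟨t, s', h1, h2, h3⟩ := h
  exact ⟨t, s', h1, h2.trans hT, hQ s' h1.frame h3⟩

theorem Runs.seq {W : ℕ} {P P' : Prog} {s : State} {T T' : ℕ} {R Q : State → Prop}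
    (h : Runs W P s T R) (h' : ∀ s', Frame P s s' → R s' → Runs W P' s' T' Q) :
    Runs W (.seq P P') s (T + T') Q := by
  obtain ⟨t, s', h1, h2, h3⟩ := h
  obtain ⟨t', s'', h1', h2', h3'⟩ := h' s' h1.frame h3
  exact ⟨t + t', s'', h1.seq h1', by omega, h3'⟩

theorem Runs.ite {W : ℕ} {b : Test} {P P' : Prog} {s : State} {T : ℕ} {Q : State → Prop}
    (h : b.Holds s → Runs W P s T Q) (h' : ¬ b.Holds s → Runs W P' s T Q) :
    Runs W (.ite b P P') s (T + 1) Q := by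
  by_cases hb : b.Holds s
  · obtain ⟨t, s', h1, h2, h3⟩ := h hb
    exact ⟨t + 1, s', .ite_true hb h1, by omega, h3⟩
  · obtain ⟨t, s', h1, h2, h3⟩ := h' hb
    exact ⟨t + 1, s', .ite_false hb h1, by omega, h3⟩

theorem Runs.skip {W : ℕ} {s : State} {T : ℕ} {Q : State → Prop} (hT : 1 ≤ T) (h : Q s) :
    Runs W .skip s T Q := ⟨1, s, .skip s, hT, h⟩

/-! ### Programs without loops, and counting loops -/

/-- Programs without loops. -/
def Prog.loopFree : Prog → Bool
  | skip => true
  | instr _ => true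
  | seq p q => p.loopFree && q.loopFree
  | ite _ p q => p.loopFree && q.loopFree
  | .while _ _ => false

/-- An upper bound on the running time of a program without loops. -/
def Prog.cost : Prog → ℕ
  | skip => 1
  | instr _ => 1
  | seq p q => p.cost + q.cost
  | ite _ p q => p.cost + q.cost + 1
  | .while _ _ => 0

/-- The weakest precondition of a program without loops. -/
def Prog.wp (W : ℕ) : Prog → (State → Prop) → State → Prop
  | skip, Q, s => Q s
  | instr i, Q, s => i.Fits W s ∧ Q (i.run s)
  | seq p q, Q, s => p.wp W (q.wp W Q) s
  | ite b p q, Q, s => (b.Holds s → p.wp W Q s) ∧ (¬ b.Holds s → q.wp W Q s)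
  | .while _ _, _, _ => False

/-- Straight-line code is reduced to a statement about one explicit state, which `simp` can unfold;
the time bound is found by evaluating `Prog.cost`. -/
theorem Prog.runs_of_wp {W : ℕ} {P : Prog} : ∀ {s : State} {Q : State → Prop},
    P.loopFree = true → P.wp W Q s → Runs W P s P.cost Q := by
  induction P with
  | skip => exact fun _ h => Runs.skip le_rfl h
  | instr i => exact fun _ h => ⟨1, _, .instr i _ h.1, le_rfl, h.2⟩
  | seq p q hp hq =>
    intro s Q hl h
    simp only [Prog.loopFree, Bool.and_eq_true] at hl
    exact (hp hl.1 h).seq fun s' _ h' => hq hl.2 h'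
  | ite b p q hp hq =>
    intro s Q hl h
    simp only [Prog.loopFree, Bool.and_eq_true] at hl
    exact Runs.ite (fun hb => (hp hl.1 (h.1 hb)).mono (by omega) fun _ _ h => h)
      (fun hb => (hq hl.2 (h.2 hb)).mono (by omega) fun _ _ h => h)
  | _ => intro s Q hl; simp [Prog.loopFree] at hl

/-- The state with a new value in one register. -/
def State.set (s : State) (x v : ℕ) : State := { s with reg := Function.update s.reg x v }

/-- The state with a new value in one array cell. -/
def State.setArr (s : State) (a i v : ℕ) : State :=
  { s with arr := Function.update s.arr a (Function.update (s.arr a) i v) }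

@[simp] theorem State.set_reg (s : State) (x v r : ℕ) :
    (s.set x v).reg r = if r = x then v else s.reg r := Function.update_apply ..

@[simp] theorem State.set_arr (s : State) (x v : ℕ) : (s.set x v).arr = s.arr := rfl

@[simp] theorem State.setArr_reg (s : State) (a i v : ℕ) : (s.setArr a i v).reg = s.reg := rfl

@[simp] theorem State.setArr_arr (s : State) (a i v b : ℕ) :
    (s.setArr a i v).arr b = if b = a then Function.update (s.arr a) i v else s.arr b :=
  Function.update_apply ..

@[simp] theorem Instr.run_const (s : State) (x c : ℕ) : (const x c).run s = s.set x c := rfl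

@[simp] theorem Instr.run_copy (s : State) (x y : ℕ) : (copy x y).run s = s.set x (s.reg y) := rfl

@[simp] theorem Instr.run_arith (s : State) (o : Op) (x y z : ℕ) :
    (arith o x y z).run s = s.set x (o.eval (s.reg y) (s.reg z)) := rfl

@[simp] theorem Instr.run_load (s : State) (x a i : ℕ) :
    (load x a i).run s = s.set x (s.arr a (s.reg i)) := rfl

@[simp] theorem Instr.run_store (s : State) (a i x : ℕ) :
    (store a i x).run s = s.setArr a (s.reg i) (s.reg x) := rfl

/-- `for i := 0, 1, …` as long as `i` is smaller than register `hi`. Register `3` must hold `1`. -/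
def Prog.forLoop (i hi : ℕ) (body : Prog) : Prog :=
  .seq (.instr (.const i 0)) (.while (.lt i hi) (.seq body (.instr (.arith .add i i 3))))

theorem Prog.writesReg_forLoop (i hi : ℕ) (body : Prog) (r : ℕ) :
    (forLoop i hi body).writesReg r = ((i == r) || body.writesReg r) := by
  simp only [forLoop, writesReg, Instr.writesReg]
  cases (i == r) <;> simp

theorem Prog.writesArr_forLoop (i hi : ℕ) (body : Prog) (a : ℕ) :
    (forLoop i hi body).writesArr a = body.writesArr a := by
  simp [forLoop, writesArr, Instr.writesArr]

/-- Induction on the number of remaining iterations. Each iteration costs the body, a test and an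
increment; the final 2 pays for the initial assignment and the last test. `hI` says that the
invariant does not depend on the counter register, and `hBW` keeps the counter within a word. -/
theorem Runs.forLoop {W i hi B Tb : ℕ} {body : Prog} {s : State} (I : ℕ → State → Prop)
    (hwi : body.writesReg i = false) (hwhi : body.writesReg hi = false)
    (hw3 : body.writesReg 3 = false) (hihi : i ≠ hi) (hi3 : i ≠ 3)
    (hB : s.reg hi = B) (h3 : s.reg 3 = 1) (hBW : B < W)
    (hI : ∀ j s v, I j s → I j (s.set i v)) (h0 : I 0 s)
    (hstep : ∀ j < B, ∀ s₁, Frame (.forLoop i hi body) s s₁ → s₁.reg i = j → I j s₁ →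
      Runs W body s₁ Tb (I (j + 1))) :
    Runs W (.forLoop i hi body) s (B * (Tb + 2) + 2) (I B) := by
  have hfb : ∀ {s₁ s₂}, Frame body s₁ s₂ → Frame (.forLoop i hi body) s₁ s₂ := fun h =>
    h.mono (fun r hr => by
      rw [Prog.writesReg_forLoop, Bool.or_eq_false_iff] at hr; exact hr.2)
      (fun a ha => by rwa [Prog.writesArr_forLoop] at ha)
  have hfset : ∀ s₁ v, Frame (.forLoop i hi body) s₁ (s₁.set i v) := fun s₁ v =>
    ⟨fun r hr => by
      rw [Prog.writesReg_forLoop, Bool.or_eq_false_iff] at hr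
      have : r ≠ i := fun e => by simp [e] at hr
      simp [this], fun a _ => rfl⟩
  have hfhi : (Prog.forLoop i hi body).writesReg hi = false := by
    rw [Prog.writesReg_forLoop, hwhi]; simp [hihi]
  have hf3 : (Prog.forLoop i hi body).writesReg 3 = false := by
    rw [Prog.writesReg_forLoop, hw3]; simp [hi3]
  have key : ∀ e j, j + e = B → ∀ s₁, Frame (.forLoop i hi body) s s₁ → s₁.reg i = j → I j s₁ →
      Runs W (.while (.lt i hi) (.seq body (.instr (.arith .add i i 3)))) s₁ (e * (Tb + 2) + 1)
        (I B) := by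
    intro e
    induction e with
    | zero =>
      intro j hj s₁ hf hr hIj
      obtain rfl : j = B := by omega
      refine ⟨1, s₁, .while_false ?_, by omega, hIj⟩
      simp only [Test.Holds, hr, hf.1 hi hfhi, hB, lt_irrefl, not_false_eq_true]
    | succ e ih =>
      intro j hj s₁ hf hr hIj
      obtain ⟨t, s₂, hx, ht, hI2⟩ := hstep j (by omega) s₁ hf hr hIj
      have hf2 := hx.frame
      have hr2 : s₂.reg i = j := (hf2.1 i hwi).trans hr
      have h32 : s₂.reg 3 = 1 := (hf2.1 3 hw3).trans ((hf.1 3 hf3).trans h3)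
      obtain ⟨t', s₃, hx', ht', hI3⟩ := ih (j + 1) (by omega) (s₂.set i (j + 1))
        ((hf.trans (hfb hf2)).trans (hfset _ _)) (by simp) (hI _ _ _ hI2)
      have hx3 : Exec W (.instr (.arith .add i i 3)) s₂ 1 (s₂.set i (j + 1)) := by
        have := Exec.instr (W := W) (.arith .add i i 3) s₂
          (by simp only [Instr.Fits, Op.eval, hr2, h32]; omega)
        simpa [Op.eval, hr2, h32] using this
      refine ⟨t + 1 + t' + 1, s₃, .while_true ?_ (hx.seq hx3) hx', ?_, hI3⟩
      · simp only [Test.Holds, hr, hf.1 hi hfhi, hB]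
        omega
      · rw [Nat.succ_mul]; omega
  obtain ⟨t, s', hx, ht, hI'⟩ := key B 0 (by omega) (s.set i 0) (hfset _ _) (by simp) (hI _ _ _ h0)
  refine ⟨1 + t, s', .seq (.instr (.const i 0) s ?_) hx, by omega, hI'⟩
  simp only [Instr.Fits]
  omega

/-- A conditional without an alternative. -/
abbrev Prog.ifThen (b : Test) (p : Prog) : Prog := .ite b p .skip

/-- Executes the instructions in the list, and then the program. -/
def Prog.block (is : List Instr) (p : Prog) : Prog := is.foldr (fun i q => .seq (.instr i) q) p

/-! ### Constants of the search, and lists of vertices -/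

/-- The registers that hold constants during the search. -/
def constRegs : List ℕ := [0, 1, 3, 4, 5, 6, 7]

/-- What does not change during the search: the parameters `n`, `k`, `l` and `m`, the adjacency
matrix, and the outdegrees, which are in array `6`. -/
structure Ctx {n : ℕ} (T : Digraph (Fin n)) (k l m : ℕ) (s : State) : Prop where
  reg_zero : s.reg 0 = n
  reg_one : s.reg 1 = k
  reg_three : s.reg 3 = 1
  reg_four : s.reg 4 = 0
  reg_five : s.reg 5 = l
  reg_six : s.reg 6 = m
  reg_seven : s.reg 7 = 3 * m
  arr_zero : ∀ u v : Fin n, s.arr 0 (u * n + v) = 1 ∧ T.Adj u v ∨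
    s.arr 0 (u * n + v) = 0 ∧ ¬ T.Adj u v
  arr_six : ∀ v : Fin n, s.arr 6 v = T.outDeg v

theorem Ctx.of_frame {n : ℕ} {T : Digraph (Fin n)} {k l m : ℕ} {P : Prog} {s s' : State}
    (h : Ctx T k l m s) (hf : Frame P s s')
    (hr : ∀ r ∈ constRegs, P.writesReg r = false)
    (h0 : P.writesArr 0 = false) (h6 : P.writesArr 6 = false) : Ctx T k l m s' where
  reg_zero := (hf.1 _ (hr 0 (by decide))).trans h.reg_zero
  reg_one := (hf.1 _ (hr 1 (by decide))).trans h.reg_one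
  reg_three := (hf.1 _ (hr 3 (by decide))).trans h.reg_three
  reg_four := (hf.1 _ (hr 4 (by decide))).trans h.reg_four
  reg_five := (hf.1 _ (hr 5 (by decide))).trans h.reg_five
  reg_six := (hf.1 _ (hr 6 (by decide))).trans h.reg_six
  reg_seven := (hf.1 _ (hr 7 (by decide))).trans h.reg_seven
  arr_zero := by rw [hf.2 0 h0]; exact h.arr_zero
  arr_six := by rw [hf.2 6 h6]; exact h.arr_six

/-- The vertices listed in the first `c` cells of an array. -/
def members (n : ℕ) (a : ℕ → ℕ) (c : ℕ) : Finset (Fin n) :=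
  Finset.univ.filter fun v => ∃ i < c, a i = v

theorem mem_members {n : ℕ} {a : ℕ → ℕ} {c : ℕ} {v : Fin n} :
    v ∈ members n a c ↔ ∃ i < c, a i = v := by simp [members]

theorem members_update {n : ℕ} (a : ℕ → ℕ) (c : ℕ) (v : Fin n) :
    members n (Function.update a c v) (c + 1) = insert v (members n a c) := by
  ext x
  simp only [mem_members, Finset.mem_insert]
  constructor
  · rintro ⟨i, hi, h⟩
    by_cases hic : i = c
    · subst hic
      rw [Function.update_self] at h
      exact Or.inl (Fin.ext h.symm)
    · rw [Function.update_of_ne hic] at h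
      exact Or.inr ⟨i, by omega, h⟩
  · rintro (rfl | ⟨i, hi, h⟩)
    · exact ⟨c, by omega, by simp⟩
    · exact ⟨i, by omega, by rw [Function.update_of_ne (by omega), h]⟩

theorem members_congr {n : ℕ} {a a' : ℕ → ℕ} {c : ℕ} (h : ∀ i < c, a' i = a i) :
    members n a' c = members n a c := by
  ext x
  simp only [mem_members]
  exact ⟨fun ⟨i, hi, e⟩ => ⟨i, hi, (h i hi) ▸ e⟩, fun ⟨i, hi, e⟩ => ⟨i, hi, (h i hi).trans e⟩⟩

theorem members_mono {n : ℕ} {a : ℕ → ℕ} {c c' : ℕ} (h : c ≤ c') :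
    members n a c ⊆ members n a c' := by
  intro x
  simp only [mem_members]
  exact fun ⟨i, hi, e⟩ => ⟨i, by omega, e⟩

theorem update_lt {n : ℕ} {a : ℕ → ℕ} (h : ∀ i, a i < n) (c : ℕ) {v : ℕ} (hv : v < n) (i : ℕ) :
    Function.update a c v i < n := by
  rw [Function.update_apply]; split
  exacts [hv, h i]

/-! ### Collecting the vertices of a window -/

/-- Appends vertex `reg 12` to the list if its outdegree is in the window. -/
def windowBody : Prog := .block [.load 15 6 12]
  (.ifThen (.le 8 15) (.ifThen (.lt 15 16) (.ifThen (.lt 10 6)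
    (.block [.store 5 10 12, .arith .add 10 10 3] .skip))))

/-- The list is cut off at m vertices; if this never happens, it contains the whole window. The
bound on array 5 is kept for all cells, also the unused ones, so that whatever is read from it is a
vertex. -/
theorem runs_window {n : ℕ} {T : Digraph (Fin n)} {k l m d W : ℕ} {s : State}
    (hc : Ctx T k l m s) (hW : n * n + n + 2 ≤ W) (hm : 3 * m + 2 ≤ n)
    (h5 : ∀ i, s.arr 5 i < n) (h8 : s.reg 8 = d) (h10 : s.reg 10 = 0)
    (h16 : s.reg 16 = d + l) :
    Runs W (.forLoop 12 0 windowBody) s (20 * n + 2) fun s' =>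
      (∀ i, s'.arr 5 i < n) ∧ s'.reg 10 ≤ m ∧
      (m ≤ (Finset.univ.filter fun v => d ≤ T.outDeg v ∧ T.outDeg v < d + l).card →
        m ≤ ((members n (s'.arr 5) (s'.reg 10)).filter
          fun v => d ≤ T.outDeg v ∧ T.outDeg v < d + l).card) := by
  refine (Runs.forLoop (Tb := 18) (B := n) (fun j s => s.reg 10 ≤ m ∧ (∀ i, s.arr 5 i < n) ∧
    (∀ x ∈ members n (s.arr 5) (s.reg 10), x.1 < j ∧ d ≤ T.outDeg x ∧ T.outDeg x < d + l) ∧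
    (members n (s.arr 5) (s.reg 10)).card = s.reg 10 ∧
    (s.reg 10 < m → ∀ x : Fin n, x.1 < j → d ≤ T.outDeg x → T.outDeg x < d + l →
      x ∈ members n (s.arr 5) (s.reg 10))) rfl rfl rfl (by decide) (by decide) hc.reg_zero
    hc.reg_three (by nlinarith) (by exact fun _ _ _ h => h) ?_ ?_).mono (by omega) ?_
  · simp [h10, h5, members]
  · rintro j hj s₁ hf hr ⟨h1, h2, h3, h4, h6⟩
    have hc₁ := hc.of_frame hf (by decide) rfl rfl
    have e8 : s₁.reg 8 = d := (hf.1 8 rfl).trans h8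
    have e16 : s₁.reg 16 = d + l := (hf.1 16 rfl).trans h16
    have e6 := hc₁.arr_six ⟨j, hj⟩
    refine (Prog.runs_of_wp rfl ?_).mono (by decide) fun _ _ h => h
    simp only [windowBody, Prog.block, List.foldr, Prog.wp, Instr.Fits, Instr.run_load,
      Instr.run_store, Instr.run_arith, Op.eval, Test.Holds, State.set_reg, State.set_arr,
      State.setArr_reg, State.setArr_arr, hr, e8, e16, e6, hc₁.reg_six, hc₁.reg_three,
      reduceIte, Nat.reduceEqDiff, true_and, not_le, not_lt]
    -- This covers every branch in which nothing is appended.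
    have hold : ¬ (d ≤ T.outDeg ⟨j, hj⟩ ∧ T.outDeg ⟨j, hj⟩ < d + l ∧ s₁.reg 10 < m) →
        s₁.reg 10 ≤ m ∧ (∀ i, s₁.arr 5 i < n) ∧
        (∀ x ∈ members n (s₁.arr 5) (s₁.reg 10), x.1 < j + 1 ∧ d ≤ T.outDeg x ∧
          T.outDeg x < d + l) ∧ (members n (s₁.arr 5) (s₁.reg 10)).card = s₁.reg 10 ∧
        (s₁.reg 10 < m → ∀ x : Fin n, x.1 < j + 1 → d ≤ T.outDeg x → T.outDeg x < d + l →
          x ∈ members n (s₁.arr 5) (s₁.reg 10)) := by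
      intro hnot
      refine ⟨h1, h2, fun x hx => ⟨by have := (h3 x hx).1; omega, (h3 x hx).2⟩, h4, ?_⟩
      intro hlt x hx hx1 hx2
      rcases Nat.lt_succ_iff_lt_or_eq.1 hx with hx | hx
      · exact h6 hlt x hx hx1 hx2
      · obtain rfl : x = ⟨j, hj⟩ := Fin.ext hx
        exact absurd ⟨hx1, hx2, hlt⟩ hnot
    refine ⟨fun g1 => ⟨fun g2 => ⟨fun g3 => ?_, fun g3 => hold (by omega)⟩,
      fun g2 => hold (by omega)⟩, fun g1 => hold (by omega)⟩
    have hu : members n (Function.update (s₁.arr 5) (s₁.reg 10) j) (s₁.reg 10 + 1) =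
      insert (⟨j, hj⟩ : Fin n) (members n (s₁.arr 5) (s₁.reg 10)) :=
      members_update _ _ (⟨j, hj⟩ : Fin n)
    have hnm : (⟨j, hj⟩ : Fin n) ∉ members n (s₁.arr 5) (s₁.reg 10) := fun h =>
      lt_irrefl _ (h3 _ h).1
    refine ⟨by omega, by omega, update_lt h2 _ hj, ?_, ?_, ?_⟩
    · intro x hx
      rw [hu, Finset.mem_insert] at hx
      rcases hx with rfl | hx
      · exact ⟨by simp, g1, g2⟩
      · exact ⟨by have := (h3 x hx).1; omega, (h3 x hx).2⟩
    · rw [hu, Finset.card_insert_of_notMem hnm, h4]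
    · intro _ x hx hx1 hx2
      rw [hu, Finset.mem_insert]
      rcases Nat.lt_succ_iff_lt_or_eq.1 hx with hx | hx
      · exact Or.inr (h6 g3 x hx hx1 hx2)
      · exact Or.inl (Fin.ext hx)
  · rintro s' - ⟨h1, h2, h3, h4, h6⟩
    refine ⟨h2, h1, fun hcard => ?_⟩
    rw [Finset.filter_true_of_mem fun x hx => (h3 x hx).2, h4]
    by_contra hlt
    rw [not_le] at hlt
    have := Finset.card_le_card (s := Finset.univ.filter fun v => d ≤ T.outDeg v ∧
      T.outDeg v < d + l) (t := members n (s'.arr 5) (s'.reg 10))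
      (fun x hx => by
        simp only [Finset.mem_filter, Finset.mem_univ, true_and] at hx
        exact h6 hlt x x.2 hx.1 hx.2)
    omega

/-! ### A greedy matching across a window -/

/-- Appends the vertices `reg 12` and `reg 13` to the list and marks them, if the first one is below
the window, the second one is above it, there is an arc, and none of the two is marked. The marks
are in row `d` of array `7`. -/
def matchBody : Prog := .block [.load 15 6 12, .load 20 6 13, .arith .mul 21 12 0,
    .arith .add 21 21 13, .load 21 0 21, .arith .add 22 17 12, .load 23 7 22,
    .arith .add 24 17 13, .load 25 7 24]
  (.ifThen (.le 15 8) (.ifThen (.le 16 20) (.ifThen (.eq 21 3) (.ifThen (.eq 23 4)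
    (.ifThen (.eq 25 4) (.ifThen (.lt 10 7) (.block [.store 5 10 12, .arith .add 10 10 3,
      .store 5 10 13, .arith .add 10 10 3, .store 7 22 3, .store 7 24 3] .skip)))))))

/-- The invariant of the greedy matching: the pairs `c i`, `h i` are its arcs, and `proc` tells
which pairs of vertices have been processed. -/
def MatchInv {n : ℕ} (T : Digraph (Fin n)) (l m d w : ℕ) (M₀ : Finset (Fin n))
    (proc : Fin n → Fin n → Prop) (s : State) : Prop :=
  (∀ i, s.arr 5 i < n) ∧ s.reg 10 ≤ 3 * m + 1 ∧ M₀ ⊆ members n (s.arr 5) (s.reg 10) ∧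
  (∀ i, (d + 1) * n ≤ i → s.arr 7 i = 0) ∧
  ∃ (r : ℕ) (c h : ℕ → Fin n), s.reg 10 = w + 2 * r ∧
    (∀ i < r, c i ∈ members n (s.arr 5) (s.reg 10) ∧ h i ∈ members n (s.arr 5) (s.reg 10) ∧
      T.Adj (c i) (h i) ∧ T.outDeg (c i) ≤ d ∧ d + l ≤ T.outDeg (h i)) ∧
    (∀ i < r, ∀ j < r, c i = c j → i = j) ∧ (∀ i < r, ∀ j < r, h i = h j → i = j) ∧
    (∀ x : Fin n, s.arr 7 (d * n + x) = 0 ↔ ∀ i < r, c i ≠ x ∧ h i ≠ x) ∧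
    (s.reg 10 < 3 * m → ∀ x y, proc x y → T.Adj x y → T.outDeg x ≤ d → d + l ≤ T.outDeg y →
      s.arr 7 (d * n + x) ≠ 0 ∨ s.arr 7 (d * n + y) ≠ 0)

/-- A pair is skipped because it is not an arc across the window, an end is already marked, or the
list is full. None of these breaks maximality, which is claimed only while the list is not full. -/
theorem MatchInv.of_not {n : ℕ} {T : Digraph (Fin n)} {l m d w : ℕ} {M₀ : Finset (Fin n)}
    {proc proc' : Fin n → Fin n → Prop} {s : State} {u v : Fin n}
    (hI : MatchInv T l m d w M₀ proc s) (hp : ∀ x y, proc' x y → proc x y ∨ x = u ∧ y = v)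
    (hnot : ¬ (T.outDeg u ≤ d ∧ d + l ≤ T.outDeg v ∧ T.Adj u v ∧ s.arr 7 (d * n + u) = 0 ∧
      s.arr 7 (d * n + v) = 0 ∧ s.reg 10 < 3 * m)) : MatchInv T l m d w M₀ proc' s := by
  obtain ⟨h1, h2, h3, h4, r, c, h, h5, h6, h7, h8, h9, h10⟩ := hI
  refine ⟨h1, h2, h3, h4, r, c, h, h5, h6, h7, h8, h9, fun hlt x y hxy hadj hx hy => ?_⟩
  rcases hp x y hxy with hxy | ⟨rfl, rfl⟩
  · exact h10 hlt x y hxy hadj hx hy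
  · by_contra hcon
    push Not at hcon
    exact hnot ⟨hx, hy, hadj, hcon.1, hcon.2, hlt⟩

/-- The new ends were unmarked, so they are new as tail and as head. Marks are never removed, so
pairs blocked before remain blocked. -/
theorem MatchInv.of_insert {n : ℕ} {T : Digraph (Fin n)} {l m d w : ℕ} {M₀ : Finset (Fin n)}
    {proc proc' : Fin n → Fin n → Prop} {s s' : State} {u v : Fin n}
    (hI : MatchInv T l m d w M₀ proc s) (hp : ∀ x y, proc' x y → proc x y ∨ x = u ∧ y = v)
    (hu : T.outDeg u ≤ d) (hv : d + l ≤ T.outDeg v) (hadj : T.Adj u v)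
    (hmu : s.arr 7 (d * n + u) = 0) (hmv : s.arr 7 (d * n + v) = 0) (hlt : s.reg 10 < 3 * m)
    (e10 : s'.reg 10 = s.reg 10 + 1 + 1)
    (e5 : s'.arr 5 = Function.update (Function.update (s.arr 5) (s.reg 10) u) (s.reg 10 + 1) v)
    (e7 : s'.arr 7 = Function.update (Function.update (s.arr 7) (d * n + u) 1) (d * n + v) 1) :
    MatchInv T l m d w M₀ proc' s' := by
  obtain ⟨h1, h2, h3, h4, r, c, h, h5, h6, h7, h8, h9, h10⟩ := hI
  have hmem : members n (s'.arr 5) (s'.reg 10) =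
      insert v (insert u (members n (s.arr 5) (s.reg 10))) := by
    rw [e5, e10, members_update, members_update]
  have hmark : ∀ x : Fin n, s'.arr 7 (d * n + x) = 0 ↔
      s.arr 7 (d * n + x) = 0 ∧ u ≠ x ∧ v ≠ x := by
    intro x
    rw [e7]
    simp only [Function.update_apply, Nat.add_left_cancel_iff]
    split_ifs with hx hx'
    · simp [Fin.ext_iff, hx]
    · simp [Fin.ext_iff, hx']
    · have e1 : u ≠ x := fun e => hx' (by rw [e])
      have e2 : v ≠ x := fun e => hx (by rw [e])
      simp [e1, e2]
  have hlast : ∀ i < r + 1, i = r ∨ i < r := fun i hi => by omega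
  have hmu' := (h9 u).1 hmu
  have hmv' := (h9 v).1 hmv
  refine ⟨?_, by omega, ?_, ?_, r + 1, Function.update c r u, Function.update h r v, by omega,
    ?_, ?_, ?_, ?_, ?_⟩
  · rw [e5]
    exact update_lt (update_lt h1 _ u.2) _ v.2
  · rw [hmem]
    exact h3.trans ((Finset.subset_insert _ _).trans (Finset.subset_insert _ _))
  · intro i hi
    have hd : ∀ x : Fin n, i ≠ d * n + x := fun x => by
      have := x.2
      rw [Nat.succ_mul] at hi
      omega
    rw [e7, Function.update_of_ne (hd v), Function.update_of_ne (hd u)]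
    exact h4 i hi
  · intro i hi
    rw [hmem]
    rcases hlast i hi with rfl | hi
    · simp only [Function.update_self, Finset.mem_insert, true_or, or_true, true_and]
      exact ⟨hadj, hu, hv⟩
    · rw [Function.update_of_ne hi.ne, Function.update_of_ne hi.ne]
      obtain ⟨g1, g2, g3⟩ := h6 i hi
      exact ⟨by simp [g1], by simp [g2], g3⟩
  · intro i hi j hj e
    rcases hlast i hi with rfl | hi <;> rcases hlast j hj with rfl | hj
    · rfl
    · rw [Function.update_self, Function.update_of_ne hj.ne] at e
      exact absurd e.symm (hmu' j hj).1
    · rw [Function.update_self, Function.update_of_ne hi.ne] at e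
      exact absurd e (hmu' i hi).1
    · rw [Function.update_of_ne hi.ne, Function.update_of_ne hj.ne] at e
      exact h7 i hi j hj e
  · intro i hi j hj e
    rcases hlast i hi with rfl | hi <;> rcases hlast j hj with rfl | hj
    · rfl
    · rw [Function.update_self, Function.update_of_ne hj.ne] at e
      exact absurd e.symm (hmv' j hj).2
    · rw [Function.update_self, Function.update_of_ne hi.ne] at e
      exact absurd e (hmv' i hi).2
    · rw [Function.update_of_ne hi.ne, Function.update_of_ne hj.ne] at e
      exact h8 i hi j hj e
  · intro x
    rw [hmark, h9]
    constructor
    · rintro ⟨g1, g2, g3⟩ i hi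
      rcases hlast i hi with rfl | hi
      · simp [g2, g3]
      · rw [Function.update_of_ne hi.ne, Function.update_of_ne hi.ne]
        exact g1 i hi
    · intro g
      refine ⟨fun i hi => ?_, ?_⟩
      · have := g i (by omega)
        rwa [Function.update_of_ne hi.ne, Function.update_of_ne hi.ne] at this
      · have := g r (by omega)
        simpa using this
  · intro hlt' x y hxy hxy' hx hy
    have hm : ∀ z : Fin n, s.arr 7 (d * n + z) ≠ 0 ∨ u = z ∨ v = z →
        s'.arr 7 (d * n + z) ≠ 0 := fun z hz e => by
      have := (hmark z).1 e
      tauto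
    rcases hp x y hxy with hxy | ⟨rfl, rfl⟩
    · rcases h10 hlt x y hxy hxy' hx hy with g | g
      · exact Or.inl (hm x (Or.inl g))
      · exact Or.inr (hm y (Or.inl g))
    · exact Or.inl (hm _ (Or.inr (Or.inl rfl)))

/-- One pass over all pairs makes the matching maximal. The list starts with at most m vertices and
grows by two per arc, so stopping at length 3m means at least m arcs; otherwise the tails and heads
cover all arcs across the window. Row d of the marks is still zero, so no clearing is needed between
thresholds. -/
theorem runs_match {n : ℕ} {T : Digraph (Fin n)} {k l m d W : ℕ} {s : State}
    (hc : Ctx T k l m s) (hW : n * n + n + 2 ≤ W) (hm : 3 * m + 2 ≤ n) (hl : 1 ≤ l) (hd : d < n)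
    (h5 : ∀ i, s.arr 5 i < n) (h7 : ∀ i, d * n ≤ i → s.arr 7 i = 0) (h8 : s.reg 8 = d)
    (h10 : s.reg 10 ≤ m) (h16 : s.reg 16 = d + l) (h17 : s.reg 17 = d * n) :
    Runs W (.forLoop 12 0 (.forLoop 13 0 matchBody)) s (n * (n * 30 + 4) + 2) fun s' =>
      (∀ i, s'.arr 5 i < n) ∧ (∀ i, (d + 1) * n ≤ i → s'.arr 7 i = 0) ∧ s'.reg 10 ≤ 3 * m + 1 ∧
      members n (s.arr 5) (s.reg 10) ⊆ members n (s'.arr 5) (s'.reg 10) ∧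
      ∃ (r : ℕ) (c h : ℕ → Fin n), (∀ i < r, c i ∈ members n (s'.arr 5) (s'.reg 10) ∧
        h i ∈ members n (s'.arr 5) (s'.reg 10) ∧
        T.Adj (c i) (h i) ∧ T.outDeg (c i) ≤ d ∧ d + l ≤ T.outDeg (h i)) ∧
      (∀ i < r, ∀ j < r, c i = c j → i = j) ∧ (∀ i < r, ∀ j < r, h i = h j → i = j) ∧
      (m ≤ r ∨ ∀ x y, T.Adj x y → T.outDeg x ≤ d → d + l ≤ T.outDeg y →
        (∃ i < r, c i = x) ∨ ∃ i < r, h i = y) := by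
  refine (Runs.forLoop (Tb := n * 30 + 2) (B := n) (fun j => MatchInv T l m d (s.reg 10)
    (members n (s.arr 5) (s.reg 10)) fun x _ => x.1 < j) rfl rfl rfl (by decide) (by decide)
    hc.reg_zero hc.reg_three (by nlinarith) (by exact fun _ _ _ h => h) ?_ ?_).mono
    le_rfl ?_
  · refine ⟨h5, by omega, Finset.Subset.refl _, fun i hi => h7 i (by rw [Nat.succ_mul] at hi; omega),
      0, fun _ => ⟨0, by omega⟩, fun _ => ⟨0, by omega⟩, rfl, by simp, by simp, by simp, ?_, by simp⟩
    intro x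
    simp [h7]
  · rintro j hj s₁ hf hr hI
    have hc₁ := hc.of_frame hf (by decide) rfl rfl
    refine (Runs.forLoop (Tb := 28) (B := n) (fun i => MatchInv T l m d (s.reg 10)
      (members n (s.arr 5) (s.reg 10)) fun x y => x.1 < j ∨ x.1 = j ∧ y.1 < i) rfl rfl rfl
      (by decide) (by decide) hc₁.reg_zero hc₁.reg_three (by nlinarith)
      (by exact fun _ _ _ h => h) (by simpa using hI) ?_).mono (by omega) ?_
    · rintro i hi s₂ hf₂ hr₂ hI₂
      have hc₂ := hc₁.of_frame hf₂ (by decide) rfl rfl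
      have e12 : s₂.reg 12 = j := (hf₂.1 12 rfl).trans hr
      have e8 : s₂.reg 8 = d := ((hf₂.1 8 rfl).trans (hf.1 8 rfl)).trans h8
      have e16 : s₂.reg 16 = d + l := ((hf₂.1 16 rfl).trans (hf.1 16 rfl)).trans h16
      have e17 : s₂.reg 17 = d * n := ((hf₂.1 17 rfl).trans (hf.1 17 rfl)).trans h17
      have e6 := hc₂.arr_six ⟨j, hj⟩
      have e6' := hc₂.arr_six ⟨i, hi⟩
      have e0 := hc₂.arr_zero ⟨j, hj⟩ ⟨i, hi⟩
      have hp : ∀ x y : Fin n, (x.1 < j ∨ x.1 = j ∧ y.1 < i + 1) →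
          (x.1 < j ∨ x.1 = j ∧ y.1 < i) ∨ x = ⟨j, hj⟩ ∧ y = ⟨i, hi⟩ := by
        intro x y h
        simp only [Fin.ext_iff]
        omega
      have hno := hI₂.of_not hp
      have hyes := fun s' => hI₂.of_insert (s' := s') hp
      simp only at e6 e6' e0 hno hyes
      have h10' := hI₂.2.1
      have b1 : j * n + n ≤ n * n := by
        have := Nat.mul_le_mul_right n (show j + 1 ≤ n by omega)
        rwa [Nat.succ_mul] at this
      have b2 : d * n + n ≤ n * n := by
        have := Nat.mul_le_mul_right n (show d + 1 ≤ n by omega)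
        rwa [Nat.succ_mul] at this
      refine (Prog.runs_of_wp rfl ?_).mono (by decide) fun _ _ h => h
      simp only [matchBody, Prog.block, List.foldr, Prog.wp, Instr.Fits, Instr.run_load,
        Instr.run_store, Instr.run_arith, Op.eval, Test.Holds, State.set_reg, State.set_arr,
        State.setArr_reg, hr₂, e8, e16, e17, e12, e6, e6', hc₂.reg_zero,
        hc₂.reg_four, hc₂.reg_seven, hc₂.reg_three, reduceIte, Nat.reduceEqDiff, true_and, not_lt,
        not_le]
      refine ⟨by omega, by omega, by omega, by omega,
        fun g1 => ⟨fun g2 => ⟨fun g3 => ⟨fun g4 => ⟨fun g5 => ⟨fun g6 => ?_,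
          fun g6 => hno (by omega)⟩, fun g5 => hno (by tauto)⟩, fun g4 => hno (by tauto)⟩,
          fun g3 => hno ?_⟩, fun g2 => hno (by omega)⟩, fun g1 => hno (by omega)⟩
      · rcases e0 with e0 | e0
        · exact ⟨by omega, by omega, hyes _ g1 g2 e0.2 g4 g5 g6 (by simp) (by simp) (by simp)⟩
        · omega
      · rcases e0 with e0 | e0
        · exact absurd e0.1 g3
        · tauto
    · rintro s' - ⟨a1, a2, a3, a4, r, c, h, a5, a6, a7, a8, a9, a10⟩
      refine ⟨a1, a2, a3, a4, r, c, h, a5, a6, a7, a8, a9, fun hlt x y hx => a10 hlt x y ?_⟩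
      have := y.2
      omega
  · rintro s' - ⟨a1, a2, a3, a4, r, c, h, a5, a6, a7, a8, a9, a10⟩
    refine ⟨a1, a4, a2, a3, r, c, h, a6, a7, a8, ?_⟩
    by_cases hlt : s'.reg 10 < 3 * m
    · right
      intro x y hxy hx hy
      -- A marked low vertex must be a tail and a marked high vertex a head: since l ≥ 1, no
      -- outdegree is both at most d and at least d + l.
      rcases a10 hlt x y x.2 hxy hx hy with g | g <;> rw [ne_eq, a9] at g <;> push Not at g
      · obtain ⟨i, hi, g⟩ := g
        by_cases hix : c i = x
        · exact Or.inl ⟨i, hi, hix⟩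
        · have := (a6 i hi).2.2.2.2
          rw [g hix] at this
          omega
      · obtain ⟨i, hi, g⟩ := g
        by_cases hix : c i = y
        · have := (a6 i hi).2.2.2.1
          rw [hix] at this
          omega
        · exact Or.inr ⟨i, hi, g hix⟩
    · left
      omega

/-! ### Adding outneighbours of one listed vertex that are not outneighbours of another one -/

/-- Appends vertex `reg 14` to the list if it is an outneighbour of `reg 22` but not of `reg 23`,
and if fewer than `reg 5` such vertices have been appended. -/
def diffBody : Prog := .block [.arith .mul 15 22 0, .arith .add 15 15 14, .load 15 0 15,
    .arith .mul 20 23 0, .arith .add 20 20 14, .load 20 0 20]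
  (.ifThen (.eq 15 3) (.ifThen (.eq 20 4) (.ifThen (.lt 18 5)
    (.block [.store 5 10 14, .arith .add 10 10 3, .arith .add 18 18 3] .skip))))

/-- An appended vertex may already be in the list, so the length does not count members. Vertices
are scanned in increasing order, hence the counter is at most the number of listed vertices of the
difference already scanned. -/
theorem runs_diff {n : ℕ} {T : Digraph (Fin n)} {k l m c₀ x W : ℕ} {s : State} {u v : Fin n}
    (hc : Ctx T k l m s) (hW : n * n + n + 2 ≤ W)
    (h5 : ∀ i, s.arr 5 i < n) (h18 : s.reg 18 = 0) (h10 : s.reg 10 = c₀) (h22 : s.reg 22 = u)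
    (h23 : s.reg 23 = v) (hx : x ≤ c₀) (hl : c₀ + l ≤ n) :
    Runs W (.forLoop 14 0 diffBody) s (n * 20 + 2) fun s' =>
      (∀ i, s'.arr 5 i < n) ∧ (∀ i < x, s'.arr 5 i = s.arr 5 i) ∧
      s'.reg 10 ≤ c₀ + l ∧ c₀ ≤ s'.reg 10 ∧
      members n (s.arr 5) c₀ ⊆ members n (s'.arr 5) (s'.reg 10) ∧
      min l (T.outSet u \ T.outSet v).card ≤
        (members n (s'.arr 5) (s'.reg 10) ∩ (T.outSet u \ T.outSet v)).card := by
  have b : ∀ u : Fin n, (u : ℕ) * n + n ≤ n * n := by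
    intro u
    have := Nat.mul_le_mul_right n (show (u : ℕ) + 1 ≤ n from u.2)
    rwa [Nat.succ_mul] at this
  refine (Runs.forLoop (Tb := 18) (B := n) (fun j s' => (∀ i, s'.arr 5 i < n) ∧
      (∀ i < x, s'.arr 5 i = s.arr 5 i) ∧ s'.reg 10 = c₀ + s'.reg 18 ∧ s'.reg 18 ≤ l ∧
      members n (s.arr 5) c₀ ⊆ members n (s'.arr 5) (s'.reg 10) ∧
      s'.reg 18 ≤ ((members n (s'.arr 5) (s'.reg 10) ∩ (T.outSet u \ T.outSet v)).filter
        fun y => y.1 < j).card ∧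
      (s'.reg 18 < l → ∀ y : Fin n, y.1 < j → T.Adj u y → ¬ T.Adj v y →
        y ∈ members n (s'.arr 5) (s'.reg 10)))
    rfl rfl rfl (by decide) (by decide) hc.reg_zero hc.reg_three (by nlinarith)
    (by exact fun _ _ _ h => h) ?_ ?_).mono (by omega) ?_
  · simp [h5, h10, h18]
  · rintro j hj s₁ hf hr ⟨a1, a2, a3, a4, a5, a6, a7⟩
    have hc₁ := hc.of_frame hf (by decide) rfl rfl
    have e22 : s₁.reg 22 = u := (hf.1 22 rfl).trans h22
    have e23 : s₁.reg 23 = v := (hf.1 23 rfl).trans h23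
    have e0 := hc₁.arr_zero u ⟨j, hj⟩
    have e0' := hc₁.arr_zero v ⟨j, hj⟩
    have bu := b u
    have bv := b v
    simp only at e0 e0'
    have hold : ¬ (T.Adj u ⟨j, hj⟩ ∧ ¬ T.Adj v ⟨j, hj⟩ ∧ s₁.reg 18 < l) →
        (∀ i, s₁.arr 5 i < n) ∧ (∀ i < x, s₁.arr 5 i = s.arr 5 i) ∧
        s₁.reg 10 = c₀ + s₁.reg 18 ∧ s₁.reg 18 ≤ l ∧
        members n (s.arr 5) c₀ ⊆ members n (s₁.arr 5) (s₁.reg 10) ∧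
        s₁.reg 18 ≤ ((members n (s₁.arr 5) (s₁.reg 10) ∩ (T.outSet u \ T.outSet v)).filter
          fun y => y.1 < j + 1).card ∧
        (s₁.reg 18 < l → ∀ y : Fin n, y.1 < j + 1 → T.Adj u y → ¬ T.Adj v y →
          y ∈ members n (s₁.arr 5) (s₁.reg 10)) := by
      intro hnot
      refine ⟨a1, a2, a3, a4, a5, a6.trans (Finset.card_le_card
        (Finset.monotone_filter_right _ fun y _ hy => by omega)), fun hlt y hy hy1 hy2 => ?_⟩
      rcases Nat.lt_succ_iff_lt_or_eq.1 hy with hy | hy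
      · exact a7 hlt y hy hy1 hy2
      · obtain rfl : y = ⟨j, hj⟩ := Fin.ext hy
        exact absurd ⟨hy1, hy2, hlt⟩ hnot
    refine (Prog.runs_of_wp rfl ?_).mono (by decide) fun _ _ h => h
    simp only [diffBody, Prog.block, List.foldr, Prog.wp, Instr.Fits, Instr.run_load,
      Instr.run_store, Instr.run_arith, Op.eval, Test.Holds, State.set_reg, State.set_arr,
      State.setArr_reg, State.setArr_arr, hr, e22, e23, hc₁.reg_zero, hc₁.reg_four,
      hc₁.reg_five, hc₁.reg_three, reduceIte, Nat.reduceEqDiff, true_and, not_lt]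
    refine ⟨by omega, by omega, by omega, by omega, fun g1 => ⟨fun g2 => ⟨fun g3 => ?_,
      fun g3 => hold (by omega)⟩, fun g2 => hold ?_⟩, fun g1 => hold ?_⟩
    · have g1' : T.Adj u ⟨j, hj⟩ := by
        rcases e0 with e0 | e0
        · exact e0.2
        · omega
      have g2' : ¬ T.Adj v ⟨j, hj⟩ := by
        rcases e0' with e0' | e0'
        · omega
        · exact e0'.2
      have hu : members n (Function.update (s₁.arr 5) (s₁.reg 10) j) (s₁.reg 10 + 1) =
        insert (⟨j, hj⟩ : Fin n) (members n (s₁.arr 5) (s₁.reg 10)) :=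
        members_update _ _ (⟨j, hj⟩ : Fin n)
      refine ⟨by omega, by omega, update_lt a1 _ hj, ?_, by omega, g3, ?_, ?_, ?_⟩
      · intro i hi
        rw [Function.update_of_ne (by omega)]
        exact a2 i hi
      · rw [hu]
        exact a5.trans (Finset.subset_insert _ _)
      · rw [hu]
        refine (Nat.succ_le_succ a6).trans ?_
        rw [Nat.succ_eq_add_one, ← Finset.card_insert_of_notMem (a := (⟨j, hj⟩ : Fin n))
          (by simp)]
        refine Finset.card_le_card fun y hy => ?_
        simp only [Finset.mem_insert, Finset.mem_filter, Finset.mem_inter, Finset.mem_sdiff,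
          Digraph.mem_outSet] at hy ⊢
        rcases hy with rfl | ⟨⟨h1, h2⟩, h3⟩
        · exact ⟨⟨Or.inl rfl, g1', g2'⟩, by simp⟩
        · exact ⟨⟨Or.inr h1, h2⟩, by omega⟩
      · intro _ y hy hy1 hy2
        rw [hu, Finset.mem_insert]
        rcases Nat.lt_succ_iff_lt_or_eq.1 hy with hy | hy
        · exact Or.inr (a7 g3 y hy hy1 hy2)
        · exact Or.inl (Fin.ext hy)
    · rcases e0' with e0' | e0'
      · tauto
      · omega
    · rcases e0 with e0 | e0
      · omega
      · tauto
  · rintro s' - ⟨a1, a2, a3, a4, a5, a6, a7⟩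
    refine ⟨a1, a2, by omega, by omega, a5, ?_⟩
    by_cases hlt : s'.reg 18 < l
    · refine (min_le_right _ _).trans (Finset.card_le_card fun y hy => ?_)
      have hy' := hy
      simp only [Finset.mem_sdiff, Digraph.mem_outSet] at hy
      exact Finset.mem_inter.2 ⟨a7 hlt y y.2 hy.1 hy.2, hy'⟩
    · exact (min_le_left _ _).trans ((not_lt.1 hlt).trans (a6.trans (Finset.card_filter_le _ _)))

/-! ### Closing the list under degree witnesses -/

/-- Closes the list of the first `reg 11` vertices. -/
def closureProg : Prog := .forLoop 12 11 (.seq (.instr (.load 22 5 12)) (.forLoop 13 11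
  (.seq (.block [.load 23 5 13, .const 18 0] .skip) (.forLoop 14 0 diffBody))))

/-- The invariant of the closure, where `proc` tells which pairs of indices have been processed. -/
def ClosureInv {n : ℕ} (T : Digraph (Fin n)) (l x : ℕ) (a : ℕ → ℕ) (b : ℕ)
    (proc : ℕ → ℕ → Prop) (s : State) : Prop :=
  (∀ i, s.arr 5 i < n) ∧ (∀ i < x, s.arr 5 i = a i) ∧ x ≤ s.reg 10 ∧ s.reg 10 ≤ x + b * l ∧
  ∀ i < x, ∀ j < x, proc i j → ∀ u v : Fin n, a i = u → a j = v →
    min l (T.outSet u \ T.outSet v).card ≤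
      (members n (s.arr 5) (s.reg 10) ∩ (T.outSet u \ T.outSet v)).card

/-- Register 11 keeps the original length x while register 10 grows. Thus only the x² original pairs
are treated, each appending at most l vertices beyond the first x cells. -/
theorem runs_closure {n : ℕ} {T : Digraph (Fin n)} {k l m x W : ℕ} {s : State}
    (hc : Ctx T k l m s) (hW : n * n + n + 2 ≤ W) (hx : x + x * x * l ≤ n)
    (h5 : ∀ i, s.arr 5 i < n) (h10 : s.reg 10 = x) (h11 : s.reg 11 = x) :
    Runs W closureProg s (x * (x * (n * 20 + 7) + 5) + 2) fun s' =>
      (∀ i, s'.arr 5 i < n) ∧ s'.reg 10 ≤ x + x * x * l ∧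
      T.IsClosure l (members n (s.arr 5) x) (members n (s'.arr 5) (s'.reg 10)) := by
  have hxn : x ≤ n := le_trans (Nat.le_add_right _ _) hx
  have hxW : x < W := by nlinarith
  refine (Runs.forLoop (Tb := x * (n * 20 + 7) + 3) (B := x)
    (fun i => ClosureInv T l x (s.arr 5) (i * x) fun i' _ => i' < i) rfl rfl rfl
    (by decide) (by decide) h11 hc.reg_three hxW (by exact fun _ _ _ h => h) ?_ ?_).mono
    le_rfl ?_
  · exact ⟨h5, fun _ _ => rfl, h10.ge, by omega, by simp⟩
  · rintro i hi s₁ hf hr hI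
    have hc₁ := hc.of_frame hf (by decide) rfl rfl
    have e11 : s₁.reg 11 = x := (hf.1 11 rfl).trans h11
    refine (Runs.seq (R := fun s' => s' = s₁.set 22 (s.arr 5 i)) (T := 1)
      (T' := x * (n * 20 + 7) + 2)
      (Prog.runs_of_wp rfl ?_) ?_).mono (by omega) (fun _ _ h => h)
    · simp [Prog.wp, Instr.Fits, hr, hI.2.1 i hi]
    rintro _ hf' rfl
    have hc₂ := hc₁.of_frame hf' (by decide) rfl rfl
    refine (Runs.forLoop (Tb := n * 20 + 5) (B := x)
      (fun j => ClosureInv T l x (s.arr 5) (i * x + j) fun i' j' => i' < i ∨ i' = i ∧ j' < j)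
      rfl rfl rfl (by decide) (by decide) (by simpa using e11) hc₂.reg_three hxW
      (by exact fun _ _ _ h => h) (by simpa [ClosureInv] using hI) ?_).mono le_rfl ?_
    · rintro j hj s₃ hf₃ hr₃ ⟨a1, a2, a3, a4, a5⟩
      have hc₃ := hc₂.of_frame hf₃ (by decide) rfl rfl
      have e22 : s₃.reg 22 = s.arr 5 i := by rw [hf₃.1 22 rfl]; simp
      refine (Runs.seq (R := fun s' => s' = (s₃.set 23 (s.arr 5 j)).set 18 0) (T := 3)
        (T' := n * 20 + 2) (Prog.runs_of_wp rfl ?_) ?_).mono (by omega) (fun _ _ h => h)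
      · simp only [Prog.block, List.foldr, Prog.wp, Instr.Fits, Instr.run_load, Instr.run_const,
          hr₃, a2 j hj]
        exact ⟨trivial, by omega, trivial⟩
      rintro _ hf₄ rfl
      have hc₄ := hc₃.of_frame hf₄ (by decide) rfl rfl
      have hij : i * x + j + 1 ≤ x * x := by
        have := Nat.mul_le_mul_right x (show i + 1 ≤ x by omega)
        rw [Nat.succ_mul] at this
        omega
      have hbl : (i * x + j) * l + l ≤ x * x * l := by
        have := Nat.mul_le_mul_right l hij
        rwa [Nat.succ_mul] at this
      refine (runs_diff (u := ⟨s.arr 5 i, h5 i⟩) (v := ⟨s.arr 5 j, h5 j⟩) (x := x) hc₄ hW a1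
        (by simp) rfl (by simpa using e22) (by simp) (by simpa using a3)
        (by simp; omega)).mono le_rfl ?_
      rintro s' - ⟨b1, b2, b3, b4, b5, b6⟩
      simp only [State.set_arr, State.set_reg, Nat.reduceEqDiff, reduceIte] at b2 b3 b4 b5 b6
      refine ⟨b1, fun i' hi' => (b2 i' hi').trans (a2 i' hi'), by omega, ?_, ?_⟩
      · rw [← add_assoc, Nat.succ_mul]; omega
      · intro i' hi' j' hj' hp u v hu hv
        by_cases hp' : i' < i ∨ i' = i ∧ j' < j
        · exact (a5 i' hi' j' hj' hp' u v hu hv).trans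
            (Finset.card_le_card (Finset.inter_subset_inter_right b5))
        · obtain ⟨rfl, rfl⟩ : i' = i ∧ j' = j := by omega
          have e1 : u = ⟨s.arr 5 i', h5 i'⟩ := Fin.ext hu.symm
          have e2 : v = ⟨s.arr 5 j', h5 j'⟩ := Fin.ext hv.symm
          rw [e1, e2]
          exact b6
    · rintro s' - ⟨a1, a2, a3, a4, a5⟩
      refine ⟨a1, a2, a3, by rwa [Nat.succ_mul], fun i' hi' j' hj' hp => a5 i' hi' j' hj' ?_⟩
      omega
  · rintro s' - ⟨a1, a2, a3, a4, a5⟩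
    refine ⟨a1, a4, ?_, ?_⟩
    · rw [← members_congr a2]
      exact members_mono a3
    · intro u hu v hv
      obtain ⟨i, hi, hiu⟩ := mem_members.1 hu
      obtain ⟨j, hj, hjv⟩ := mem_members.1 hv
      exact a5 i hi j hj hi u v hiu hjv

/-! ### Searching for a triple among the listed vertices -/

/-- Horner's scheme: g 0 + c t has first digit g 0 and then the digits of t. Every choice of indices
thus has a code that one counter reaches. -/
theorem exists_digits (c : ℕ) (K : ℕ) : ∀ g : ℕ → ℕ, (∀ i < K, g i < c) →
    ∃ t < c ^ K, ∀ i < K, t / c ^ i % c = g i := by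
  induction K with
  | zero => exact fun g _ => ⟨0, by simp, by simp⟩
  | succ K ih =>
    intro g hg
    obtain ⟨t, ht, h⟩ := ih (fun i => g (i + 1)) fun i hi => hg _ (by omega)
    have h0 := hg 0 (by omega)
    have hcpos : 0 < c := by omega
    refine ⟨g 0 + c * t, ?_, ?_⟩
    · rw [pow_succ']
      have := Nat.mul_le_mul_left c (show t + 1 ≤ c ^ K from ht)
      rw [Nat.mul_succ] at this
      omega
    · intro i hi
      rcases i with _ | i
      · simp [Nat.mod_eq_of_lt h0]
      · rw [pow_succ', ← Nat.div_div_eq_div_mul, Nat.add_mul_div_left _ _ hcpos,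
          Nat.div_eq_of_lt h0, zero_add]
        exact h i (by omega)

/-- Decodes `k` digits of `reg 20` to the base `reg 10`, and writes the vertices that they index to
array `a`. -/
def decodeProg (a : ℕ) : Prog := .forLoop 12 1 (.block [.arith .div 15 20 10,
  .arith .mul 22 15 10, .arith .sub 22 20 22, .load 22 5 22, .store a 12 22, .copy 20 15] .skip)

/-- A remainder is computed from a division and a product. Register 20 is left with the undecoded
digits, so three decodings in a row read 3k digits. -/
theorem runs_decode {k t c W a : ℕ} {s : State} (ha : a ≠ 5) (h0 : s.reg 1 = k)
    (h3 : s.reg 3 = 1) (hkW : k < W) (htW : t < W) (h20 : s.reg 20 = t) (h10 : s.reg 10 = c) :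
    Runs W (decodeProg a) s (k * 9 + 2) fun s' =>
      (∀ i < k, s'.arr a i = s.arr 5 (t / c ^ i % c)) ∧ s'.reg 20 = t / c ^ k := by
  refine (Runs.forLoop (Tb := 7) (B := k) (fun j s' =>
      (∀ i < j, s'.arr a i = s.arr 5 (t / c ^ i % c)) ∧ s'.reg 20 = t / c ^ j)
    rfl rfl rfl (by decide) (by decide) h0 h3 hkW
    (by exact fun _ _ _ h => h) (by simp [h20]) ?_).mono le_rfl (fun _ _ h => h)
  rintro j hj s₁ hf hr ⟨a1, a2⟩
  have e10 : s₁.reg 10 = c := (hf.1 10 rfl).trans h10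
  have e5 : s₁.arr 5 = s.arr 5 := hf.2 5 (by
    simp [Prog.writesArr_forLoop, Prog.block, Prog.writesArr, Instr.writesArr, ha])
  refine (Prog.runs_of_wp rfl ?_).mono (Nat.le_of_eq rfl) fun _ _ h => h
  have b1 : t / c ^ j ≤ t := Nat.div_le_self _ _
  have b2 : t / c ^ j / c ≤ t / c ^ j := Nat.div_le_self _ _
  have b3 : t / c ^ j / c * c ≤ t / c ^ j := Nat.div_mul_le_self _ _
  have e : t / c ^ j - t / c ^ j / c * c = t / c ^ j % c := by
    have := Nat.div_add_mod' (t / c ^ j) c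
    omega
  simp only [Prog.block, List.foldr, Prog.wp, Instr.Fits, Instr.run_load, Instr.run_copy,
    Instr.run_store, Instr.run_arith, Op.eval, State.set_reg, State.set_arr,
    State.setArr_reg, State.setArr_arr, hr, e10, e5, a2, e, reduceIte, Nat.reduceEqDiff, true_and]
  refine ⟨by omega, by omega, by omega, ?_, ?_⟩
  · intro i hi
    rcases Nat.lt_succ_iff_lt_or_eq.1 hi with hi | rfl
    · rw [Function.update_of_ne hi.ne]
      exact a1 i hi
    · rw [Function.update_self]
  · rw [Nat.div_div_eq_div_mul, ← pow_succ]

/-- Sets `reg 21` to `0` if the vertices number `reg 12` and `reg 13` in the arrays `2`, `3` and `4`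
violate the definition of a triple. -/
def pairBody : Prog := .block [.load 22 2 13, .load 23 3 13, .load 24 4 13,
    .arith .mul 25 15 0, .arith .add 25 25 23, .load 25 0 25, .arith .mul 21 21 25,
    .arith .mul 25 16 0, .arith .add 25 25 24, .load 25 0 25, .arith .mul 21 21 25]
  (.ite (.eq 15 24) (.instr (.const 21 0)) (.ifThen (.ne 12 13)
    (.ite (.eq 15 22) (.instr (.const 21 0)) (.ite (.eq 16 23) (.instr (.const 21 0))
      (.ifThen (.eq 17 24) (.instr (.const 21 0)))))))

/-- Sets `reg 21` to `1` if the arrays `2`, `3` and `4` hold a triple, and to `0` otherwise. -/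
def checkProg : Prog := .seq (.instr (.const 21 1)) (.forLoop 12 1
  (.seq (.block [.load 15 2 12, .load 16 3 12, .load 17 4 12, .arith .mul 18 17 0,
    .arith .add 18 18 15, .load 18 0 18, .arith .mul 21 21 18] .skip) (.forLoop 13 1 pairBody)))

/-- The conditions on a triple that concern the indices `i` and `j`. -/
def PairOK {n : ℕ} (T : Digraph (Fin n)) (a b c : ℕ → Fin n) (i j : ℕ) : Prop :=
  T.Adj (a i) (b j) ∧ T.Adj (b i) (c j) ∧ a i ≠ c j ∧
    (i ≠ j → a i ≠ a j ∧ b i ≠ b j ∧ c i ≠ c j)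

theorem isTripleFamily_iff {n : ℕ} {T : Digraph (Fin n)} {k : ℕ} {a b c : ℕ → Fin n} :
    T.IsTripleFamily k a b c ↔
      ∀ i < k, T.Adj (c i) (a i) ∧ ∀ j < k, PairOK T a b c i j := by
  constructor
  · intro h i hi
    refine ⟨h.adj_ca i hi, fun j hj => ⟨h.adj_ab i hi j hj, h.adj_bc i hi j hj, h.ne_ac i hi j hj,
      fun hij => ⟨fun e => hij (h.inj_a i hi j hj e), fun e => hij (h.inj_b i hi j hj e),
        fun e => hij (h.inj_c i hi j hj e)⟩⟩⟩
  · intro h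
    exact ⟨fun i hi j hj e => by_contra fun hij => (((h i hi).2 j hj).2.2.2 hij).1 e,
      fun i hi j hj e => by_contra fun hij => (((h i hi).2 j hj).2.2.2 hij).2.1 e,
      fun i hi j hj e => by_contra fun hij => (((h i hi).2 j hj).2.2.2 hij).2.2 e,
      fun i hi j hj => ((h i hi).2 j hj).2.2.1, fun i hi j hj => ((h i hi).2 j hj).1,
      fun i hi j hj => ((h i hi).2 j hj).2.1, fun i hi => (h i hi).1⟩

/-- Register `r` holds the truth value of `p`. -/
def Flag (s : State) (r : ℕ) (p : Prop) : Prop := s.reg r = 1 ∧ p ∨ s.reg r = 0 ∧ ¬ p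

theorem Flag.congr {s : State} {r : ℕ} {p q : Prop} (h : Flag s r p) (hpq : p ↔ q) :
    Flag s r q := by rwa [Flag, ← hpq]

theorem flag_mul {x y : ℕ} {p q : Prop} (hx : x = 1 ∧ p ∨ x = 0 ∧ ¬ p)
    (hy : y = 1 ∧ q ∨ y = 0 ∧ ¬ q) : x * y = 1 ∧ (p ∧ q) ∨ x * y = 0 ∧ ¬ (p ∧ q) := by
  rcases hx with ⟨rfl, hx⟩ | ⟨rfl, hx⟩ <;> rcases hy with ⟨rfl, hy⟩ | ⟨rfl, hy⟩ <;> simp [hx, hy]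

theorem flag_le {x : ℕ} {p : Prop} (hx : x = 1 ∧ p ∨ x = 0 ∧ ¬ p) : x ≤ 1 := by omega

/-- The flag is a product of matrix entries, each 0 or 1, and it is reset to 0 when two vertices
coincide that must differ. -/
theorem runs_check {n : ℕ} {T : Digraph (Fin n)} {k l m W : ℕ} {s : State} {a b c : ℕ → Fin n}
    (hc : Ctx T k l m s) (hW : n * n + n + 2 ≤ W) (hk : k ≤ n)
    (ha : ∀ i < k, s.arr 2 i = a i) (hb : ∀ i < k, s.arr 3 i = b i)
    (hc' : ∀ i < k, s.arr 4 i = c i) :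
    Runs W checkProg s (k * (k * 40 + 12) + 3) fun s' =>
      Flag s' 21 (T.IsTripleFamily k a b c) := by
  have hb' : ∀ u : Fin n, (u : ℕ) * n + n ≤ n * n := by
    intro u
    have := Nat.mul_le_mul_right n (show (u : ℕ) + 1 ≤ n from u.2)
    rwa [Nat.succ_mul] at this
  refine (Runs.seq (R := fun s' => s' = s.set 21 1) (T := 1) (T' := k * (k * 40 + 12) + 2)
    (Prog.runs_of_wp rfl ?_) ?_).mono (by omega) (fun _ _ h => h)
  · exact ⟨by simp only [Instr.Fits]; omega, rfl⟩
  rintro _ hf rfl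
  have hc₁ := hc.of_frame hf (by decide) rfl rfl
  refine (Runs.forLoop (Tb := k * 40 + 10) (B := k) (fun i s' => Flag s' 21
      (∀ i' < i, T.Adj (c i') (a i') ∧ ∀ j < k, PairOK T a b c i' j)) rfl rfl rfl (by decide)
    (by decide) hc₁.reg_one hc₁.reg_three (by omega) (by exact fun _ _ _ h => h)
    (by simp [Flag]) ?_).mono le_rfl (fun _ _ h => h.congr isTripleFamily_iff.symm)
  intro i hi s₁ hf₁ hr₁ hI
  have hc₂ := hc₁.of_frame hf₁ (by decide) rfl rfl
  have e2 : s₁.arr 2 = s.arr 2 := hf₁.2 2 rfl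
  have e3 : s₁.arr 3 = s.arr 3 := hf₁.2 3 rfl
  have e4 : s₁.arr 4 = s.arr 4 := hf₁.2 4 rfl
  refine (Runs.seq (R := fun s' => s'.reg 15 = a i ∧ s'.reg 16 = b i ∧ s'.reg 17 = c i ∧
      Flag s' 21 ((∀ i' < i, T.Adj (c i') (a i') ∧ ∀ j < k, PairOK T a b c i' j) ∧
        T.Adj (c i) (a i))) (T := 8) (T' := k * 40 + 2)
    (Prog.runs_of_wp rfl ?_) ?_).mono (by omega) (fun _ _ h => h)
  · have bc := hb' (c i)
    have la := (a i).2
    have key := flag_mul hI (hc₂.arr_zero (c i) (a i))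
    have hle := flag_le key
    simp only [Prog.block, List.foldr, Prog.wp, Instr.Fits, Instr.run_load, Instr.run_arith,
      Op.eval, State.set_reg, State.set_arr, hr₁, e2, e3, e4, ha i hi, hb i hi, hc' i hi,
      hc₂.reg_zero, reduceIte, Nat.reduceEqDiff, true_and, Flag]
    exact ⟨by omega, by omega, by omega, key⟩
  rintro s₂ hf₂ ⟨h15, h16, h17, hI₂⟩
  have hc₃ := hc₂.of_frame hf₂ (by decide) rfl rfl
  have e12 : s₂.reg 12 = i := (hf₂.1 12 rfl).trans hr₁
  refine (Runs.forLoop (Tb := 38) (B := k) (fun j s' => Flag s' 21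
      (((∀ i' < i, T.Adj (c i') (a i') ∧ ∀ j < k, PairOK T a b c i' j) ∧
        T.Adj (c i) (a i)) ∧ ∀ j' < j, PairOK T a b c i j')) rfl rfl rfl (by decide)
    (by decide) hc₃.reg_one hc₃.reg_three (by omega) (by exact fun _ _ _ h => h)
    (hI₂.congr (by simp)) ?_).mono le_rfl (fun _ _ h => h.congr ?_)
  · intro j hj s₃ hf₃ hr₃ hI₃
    have hc₄ := hc₃.of_frame hf₃ (by decide) rfl rfl
    have e2' : s₃.arr 2 = s.arr 2 := ((hf₃.2 2 rfl).trans (hf₂.2 2 rfl)).trans e2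
    have e3' : s₃.arr 3 = s.arr 3 := ((hf₃.2 3 rfl).trans (hf₂.2 3 rfl)).trans e3
    have e4' : s₃.arr 4 = s.arr 4 := ((hf₃.2 4 rfl).trans (hf₂.2 4 rfl)).trans e4
    have e15 : s₃.reg 15 = a i := (hf₃.1 15 rfl).trans h15
    have e16 : s₃.reg 16 = b i := (hf₃.1 16 rfl).trans h16
    have e17 : s₃.reg 17 = c i := (hf₃.1 17 rfl).trans h17
    have e12' : s₃.reg 12 = i := (hf₃.1 12 rfl).trans e12
    have ba := hb' (a i)
    have bb := hb' (b i)
    have lb := (b j).2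
    have lc := (c j).2
    have key₁ := flag_mul hI₃ (hc₄.arr_zero (a i) (b j))
    have key₂ := flag_mul key₁ (hc₄.arr_zero (b i) (c j))
    have hle₁ := flag_le key₁
    have hle₂ := flag_le key₂
    have hsucc : ∀ {p : Prop}, (p ∧ ∀ j' < j + 1, PairOK T a b c i j') ↔
        (p ∧ ∀ j' < j, PairOK T a b c i j') ∧ PairOK T a b c i j := by
      intro p
      rw [Nat.forall_lt_succ_right, and_assoc]
    refine (Prog.runs_of_wp rfl ?_).mono (by decide) fun _ _ h => Flag.congr h hsucc.symm
    have hW0 : 0 < W := by omega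
    simp only [pairBody, Prog.block, List.foldr, Prog.wp, Instr.Fits, Instr.run_load,
      Instr.run_arith, Instr.run_const, Test.Holds,
      Op.eval, State.set_reg, State.set_arr, hr₃, e2', e3', e4', e15, e16, e17, e12', ha j hj,
      hb j hj, hc' j hj, hc₄.reg_zero, reduceIte, Nat.reduceEqDiff, true_and, Flag,
      Fin.val_inj, hW0, zero_ne_one, false_and, false_or]
    have hneg : ∀ h : (((∀ i' < i, T.Adj (c i') (a i') ∧ ∀ j < k, PairOK T a b c i' j) ∧
        T.Adj (c i) (a i)) ∧ ∀ j' < j, PairOK T a b c i j') ∧ PairOK T a b c i j,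
        (((∀ i' < i, T.Adj (c i') (a i') ∧ ∀ j < k, PairOK T a b c i' j) ∧
        T.Adj (c i) (a i)) ∧ ∀ j' < j, PairOK T a b c i j') ∧ T.Adj (a i) (b j) ∧
        T.Adj (b i) (c j) := fun h => ⟨h.1, h.2.1, h.2.2.1⟩
    rw [and_assoc] at key₂
    refine ⟨by omega, by omega, by omega, by omega, by omega, by omega,
      fun g1 h => h.2.2.2.1 g1, fun g1 => ⟨fun g2 => ⟨fun g3 h => (h.2.2.2.2 g2).1 g3,
        fun g3 => ⟨fun g4 h => (h.2.2.2.2 g2).2.1 g4, fun g4 =>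
        ⟨fun g5 h => (h.2.2.2.2 g2).2.2 g5, fun g5 => ?_⟩⟩⟩, fun g2 => ?_⟩⟩
    · exact key₂.imp (fun h => ⟨h.1, h.2.1, h.2.2.1, h.2.2.2, g1, fun _ => ⟨g3, g4, g5⟩⟩)
        (fun h => ⟨h.1, fun h' => h.2 (hneg h')⟩)
    · exact key₂.imp (fun h => ⟨h.1, h.2.1, h.2.2.1, h.2.2.2, g1, fun g => absurd g g2⟩)
        (fun h => ⟨h.1, fun h' => h.2 (hneg h')⟩)
  · rw [Nat.forall_lt_succ_right, and_assoc]

/-- Tries the numbers below `n` as codes of `3 k` indices into the list, until a triple is found. -/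
def searchProg : Prog := .forLoop 19 0 (.ifThen (.eq 9 4) (.seq (.instr (.copy 20 19))
  (.seq (decodeProg 2) (.seq (decodeProg 3) (.seq (decodeProg 4)
    (.seq checkProg (.instr (.copy 9 21))))))))

/-- Register `9` signals that the arrays `2`, `3` and `4` hold a triple. -/
def Found {n : ℕ} (T : Digraph (Fin n)) (k : ℕ) (s : State) : Prop :=
  s.reg 9 = 1 ∧ ∃ a b c : ℕ → Fin n, T.IsTripleFamily k a b c ∧
    ∀ i < k, s.arr 2 i = a i ∧ s.arr 3 i = b i ∧ s.arr 4 i = c i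

/-- All choices of 3k list positions have codes below q^(3k) ≤ n, so a failure for all codes below n
excludes every triple in the list. Codes beyond that range do no harm, as each candidate is checked.
A test takes O(k²) steps, which is O(n) as k² ≤ n. -/
theorem runs_search {n : ℕ} {T : Digraph (Fin n)} {k l m q W : ℕ} {s : State}
    (hc : Ctx T k l m s) (hW : n * n + n + 2 ≤ W) (hkn : k * k ≤ n)
    (h5 : ∀ i, s.arr 5 i < n) (h9 : s.reg 9 = 0) (h10 : s.reg 10 = q) (hq : q ^ (3 * k) ≤ n) :
    Runs W searchProg s (n * (n * 100 + 20) + 2) fun s' =>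
      Found T k s' ∨ s'.reg 9 = 0 ∧ ¬ T.HasTripleIn k (members n (s.arr 5) q) := by
  have hkn' : k ≤ n := (Nat.le_mul_self k).trans hkn
  let g : ℕ → ℕ → Fin n := fun t i => ⟨s.arr 5 (t / q ^ i % q), h5 _⟩
  refine (Runs.forLoop (Tb := n * 100 + 18) (B := n) (fun t s' => Found T k s' ∨ s'.reg 9 = 0 ∧
      ∀ t' < t, ¬ T.IsTripleFamily k (g t') (fun i => g t' (k + i)) (fun i => g t' (2 * k + i)))
    rfl rfl rfl (by decide) (by decide) hc.reg_zero hc.reg_three (by nlinarith)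
    (by exact fun _ _ _ h => h) (by simp [h9]) ?_).mono le_rfl ?_
  · intro t ht s₁ hf₁ hr₁ hI
    have hc₁ := hc.of_frame hf₁ (by decide) rfl rfl
    have e10 : s₁.reg 10 = q := (hf₁.1 10 rfl).trans h10
    have e5 : s₁.arr 5 = s.arr 5 := hf₁.2 5 rfl
    refine (Runs.ite (T := n * 100 + 17) (fun hb => ?_) (fun hb => Runs.skip (by omega) ?_)).mono
      le_rfl (fun _ _ h => h)
    · have h0 : s₁.reg 9 = 0 := by
        simpa [Test.Holds, hc₁.reg_four] using hb
      have hI' : ∀ t' < t, ¬ T.IsTripleFamily k (g t') (fun i => g t' (k + i))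
          (fun i => g t' (2 * k + i)) := by
        rcases hI with hI | hI
        · exact absurd (hI.1.symm.trans h0) one_ne_zero
        · exact hI.2
      have hkW : k < W := by omega
      have htW : t < W := by omega
      refine (Runs.seq (T := 1) (T' := (k * 9 + 2) + ((k * 9 + 2) + ((k * 9 + 2) +
        ((k * (k * 40 + 12) + 3) + 1)))) (R := fun s' => s'.reg 20 = t)
        (Prog.runs_of_wp rfl ?_) ?_).mono (by nlinarith) (fun _ _ h => h)
      · simp [Prog.wp, Instr.Fits, hr₁]
      intro s₂ hf₂ h20
      have hc₂ := hc₁.of_frame hf₂ (by decide) rfl rfl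
      have e10₂ : s₂.reg 10 = q := (hf₂.1 10 rfl).trans e10
      have e5₂ : s₂.arr 5 = s.arr 5 := (hf₂.2 5 rfl).trans e5
      refine (runs_decode (by decide) hc₂.reg_one hc₂.reg_three hkW htW h20 e10₂).seq ?_
      rintro s₃ hf₃ ⟨h2, h20₃⟩
      have hc₃ := hc₂.of_frame hf₃ (by decide) rfl rfl
      have e10₃ : s₃.reg 10 = q := (hf₃.1 10 rfl).trans e10₂
      have e5₃ : s₃.arr 5 = s.arr 5 := (hf₃.2 5 rfl).trans e5₂
      refine (runs_decode (by decide) hc₃.reg_one hc₃.reg_three hkW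
        (lt_of_le_of_lt (Nat.div_le_self _ _) htW) h20₃ e10₃).seq ?_
      rintro s₄ hf₄ ⟨h3, h20₄⟩
      have hc₄ := hc₃.of_frame hf₄ (by decide) rfl rfl
      have e10₄ : s₄.reg 10 = q := (hf₄.1 10 rfl).trans e10₃
      have e5₄ : s₄.arr 5 = s.arr 5 := (hf₄.2 5 rfl).trans e5₃
      refine (runs_decode (by decide) hc₄.reg_one hc₄.reg_three hkW
        (lt_of_le_of_lt ((Nat.div_le_self _ _).trans (Nat.div_le_self _ _)) htW) h20₄ e10₄).seq ?_
      rintro s₅ hf₅ ⟨h4, -⟩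
      have hc₅ := hc₄.of_frame hf₅ (by decide) rfl rfl
      have ha : ∀ i < k, s₅.arr 2 i = g t i := fun i hi => by
        rw [hf₅.2 2 rfl, hf₄.2 2 rfl, h2 i hi, e5₂]
      have hb : ∀ i < k, s₅.arr 3 i = g t (k + i) := fun i hi => by
        rw [hf₅.2 3 rfl, h3 i hi, e5₃, Nat.div_div_eq_div_mul, ← pow_add]
      have hc' : ∀ i < k, s₅.arr 4 i = g t (2 * k + i) := fun i hi => by
        rw [h4 i hi, e5₄, Nat.div_div_eq_div_mul, ← pow_add, Nat.div_div_eq_div_mul, ← pow_add,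
          ← add_assoc, ← two_mul]
      refine (runs_check hc₅ hW hkn' ha hb hc').seq ?_
      intro s₆ hf₆ h6
      have d2 := hf₆.2 2 rfl
      have d3 := hf₆.2 3 rfl
      have d4 := hf₆.2 4 rfl
      refine Prog.runs_of_wp rfl ⟨trivial, ?_⟩
      rcases h6 with h6 | h6
      · refine Or.inl ⟨by simp [h6.1], _, _, _, h6.2, fun i hi => ?_⟩
        simp only [Instr.run_copy, State.set_arr, d2, d3, d4]
        exact ⟨ha i hi, hb i hi, hc' i hi⟩
      · refine Or.inr ⟨by simp [h6.1], fun t' ht' => ?_⟩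
        rcases Nat.lt_succ_iff_lt_or_eq.1 ht' with ht' | rfl
        · exact hI' t' ht'
        · exact h6.2
    · rcases hI with hI | hI
      · exact Or.inl hI
      · exact absurd (by simp [Test.Holds, hc₁.reg_four, hI.1]) hb
  · rintro s' - (h | ⟨h, h'⟩)
    · exact Or.inl h
    · refine Or.inr ⟨h, ?_⟩
      rintro ⟨a, b, c, habc, hmem⟩
      -- A list position for each vertex of the triple, with the three orderings concatenated; these
      -- positions are the digits of the code.
      have hex : ∀ i, ∃ j, i < 3 * k → j < q ∧ s.arr 5 j =
          if i < k then (a i : ℕ) else if i < 2 * k then b (i - k) else c (i - 2 * k) := by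
        intro i
        by_cases hi : i < 3 * k
        · split_ifs with h1 h2
          · obtain ⟨j, hj⟩ := mem_members.1 (hmem i h1).1
            exact ⟨j, fun _ => hj⟩
          · obtain ⟨j, hj⟩ := mem_members.1 (hmem (i - k) (by omega)).2.1
            exact ⟨j, fun _ => hj⟩
          · obtain ⟨j, hj⟩ := mem_members.1 (hmem (i - 2 * k) (by omega)).2.2
            exact ⟨j, fun _ => hj⟩
        · exact ⟨0, fun h => absurd h hi⟩
      choose e he using hex
      obtain ⟨t, ht, hdig⟩ := exists_digits q (3 * k) e fun i hi => (he i hi).1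
      refine h' t (ht.trans_le hq) (isTripleFamily_iff.2 ?_)
      have ga : ∀ i < k, g t i = a i := fun i hi => by
        apply Fin.ext
        simp only [g, hdig i (by omega), (he i (by omega)).2, hi, if_true]
      have gb : ∀ i < k, g t (k + i) = b i := fun i hi => by
        apply Fin.ext
        simp only [g, hdig (k + i) (by omega), (he (k + i) (by omega)).2]
        rw [if_neg (by omega), if_pos (by omega), Nat.add_sub_cancel_left]
      have gc : ∀ i < k, g t (2 * k + i) = c i := fun i hi => by
        apply Fin.ext
        simp only [g, hdig (2 * k + i) (by omega), (he (2 * k + i) (by omega)).2]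
        rw [if_neg (by omega), if_neg (by omega), Nat.add_sub_cancel_left]
      intro i hi
      have h := isTripleFamily_iff.1 habc i hi
      refine ⟨by simpa only [ga i hi, gc i hi] using h.1, fun j hj => ?_⟩
      have h2 := h.2 j hj
      simpa only [PairOK, ga i hi, gb i hi, gc i hi, ga j hj, gb j hj, gc j hj] using h2

/-! ### One threshold -/

/-- A threshold at which the search succeeds: there is a large window, or the arcs across the window
have no small cover. -/
def GoodThreshold {n : ℕ} (T : Digraph (Fin n)) (m l d : ℕ) : Prop :=
  m ≤ (Finset.univ.filter fun v => d ≤ T.outDeg v ∧ T.outDeg v < d + l).card ∨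
    ∀ C D : Finset (Fin n), C.card < m → D.card < m →
      (∀ v ∈ C, T.outDeg v ≤ d) → (∀ v ∈ D, d + l ≤ T.outDeg v) →
      ∃ u v, T.Adj u v ∧ T.outDeg u ≤ d ∧ d + l ≤ T.outDeg v ∧ u ∉ C ∧ v ∉ D

/-- The search for a triple with threshold `reg 8`. -/
def thresholdProg : Prog := .seq (.block [.const 10 0, .arith .add 16 8 5, .arith .mul 17 8 0] .skip)
  (.seq (.forLoop 12 0 windowBody) (.seq (.forLoop 12 0 (.forLoop 13 0 matchBody))
    (.seq (.instr (.copy 11 10)) (.seq closureProg searchProg))))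

/-- The inequalities between the parameters that the search relies on. -/
structure Params (k r₁ r m n : ℕ) : Prop where
  one_le_k : 1 ≤ k
  le_r₁ : 16 ^ (16 * (3 * k)) ≤ r₁
  le_r : 16 ^ (16 * r₁) ≤ r
  le_m : 16 ^ (16 * (7 * r)) ≤ m
  one_le_r : 1 ≤ r
  one_le_m : 1 ≤ m
  m_le : 3 * m + 2 ≤ n
  k_mul_k_le : k * k ≤ n
  sq_le : (3 * m + 1) * (3 * m + 1) ≤ n
  size_le : (3 * m + 1) + (3 * m + 1) * (3 * m + 1) * (3 * r) ≤ n
  pow_le : ((3 * m + 1) + (3 * m + 1) * (3 * m + 1) * (3 * r)) ^ (3 * k) ≤ n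

/-- At most 3m + 1 vertices are listed before the closure, so `Params` bounds the closed list and
the number of codes by n, and each stage takes O(n²) steps. A good threshold puts a large window or
a large matching into the list. -/
theorem runs_threshold {n : ℕ} {T : Digraph (Fin n)} (hT : T.IsSemicomplete) {k r₁ r m d W : ℕ}
    (hp : Params k r₁ r m n) {s : State} (hc : Ctx T k (3 * r) m s) (hW : n * n + n + 2 ≤ W)
    (hd : d < n) (h5 : ∀ i, s.arr 5 i < n) (h7 : ∀ i, d * n ≤ i → s.arr 7 i = 0)
    (h8 : s.reg 8 = d) (h9 : s.reg 9 = 0) :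
    Runs W thresholdProg s (n * n * 300) fun s' =>
      (∀ i, s'.arr 5 i < n) ∧ (∀ i, (d + 1) * n ≤ i → s'.arr 7 i = 0) ∧
      (Found T k s' ∨ s'.reg 9 = 0 ∧ ¬ GoodThreshold T m (3 * r) d) := by
  have hm := hp.m_le
  have hr := hp.one_le_r
  have hs := hp.size_le
  have hdn : d * n ≤ n * n := Nat.mul_le_mul_right n hd.le
  have hrn : 3 * r ≤ n := by
    refine le_trans (Nat.le_mul_of_pos_left _ ?_) (le_trans (Nat.le_add_left _ _) hs)
    positivity
  have hn2 : n + n ≤ n * n + n := by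
    have := Nat.le_mul_self n
    omega
  have hx : ∀ x ≤ 3 * m + 1, x * x ≤ n ∧ x + x * x * (3 * r) ≤ n ∧
      (x + x * x * (3 * r)) ^ (3 * k) ≤ n := by
    intro x hx
    have hxx : x * x ≤ (3 * m + 1) * (3 * m + 1) := Nat.mul_le_mul hx hx
    have h1 : x + x * x * (3 * r) ≤ (3 * m + 1) + (3 * m + 1) * (3 * m + 1) * (3 * r) :=
      Nat.add_le_add hx (Nat.mul_le_mul_right _ hxx)
    exact ⟨hxx.trans hp.sq_le, h1.trans hs, (Nat.pow_le_pow_left h1 _).trans hp.pow_le⟩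
  refine (Runs.seq (T := 4) (T' := (20 * n + 2) + ((n * (n * 30 + 4) + 2) + (1 +
    ((n * n * 20 + n * 12 + 2) + (n * (n * 100 + 20) + 2)))))
    (R := fun s' => s'.reg 10 = 0 ∧ s'.reg 16 = d + 3 * r ∧ s'.reg 17 = d * n)
    (Prog.runs_of_wp rfl ?_) ?_).mono (by nlinarith) (fun _ _ h => h)
  · simp only [Prog.block, List.foldr, Prog.wp, Instr.Fits, Instr.run_const, Instr.run_arith,
      Op.eval, State.set_reg, h8, hc.reg_five, hc.reg_zero, reduceIte, Nat.reduceEqDiff, true_and]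
    exact ⟨by omega, by omega, by omega, trivial⟩
  rintro s₁ hf₁ ⟨h10, h16, h17⟩
  have hc₁ := hc.of_frame hf₁ (by decide) rfl rfl
  refine (runs_window hc₁ hW hm (by rwa [hf₁.2 5 rfl]) ((hf₁.1 8 rfl).trans h8) h10 h16).seq ?_
  rintro s₂ hf₂ ⟨a5, a10, aw⟩
  have hc₂ := hc₁.of_frame hf₂ (by decide) rfl rfl
  refine (runs_match hc₂ hW hm (by omega) hd a5 (by rwa [hf₂.2 7 rfl, hf₁.2 7 rfl])
    ((hf₂.1 8 rfl).trans ((hf₁.1 8 rfl).trans h8)) a10 ((hf₂.1 16 rfl).trans h16)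
    ((hf₂.1 17 rfl).trans h17)).seq ?_
  rintro s₃ hf₃ ⟨b5, b7, b10, bsub, q, c, h, bmem, bc, bh, bcov⟩
  have hc₃ := hc₂.of_frame hf₃ (by decide) rfl rfl
  refine (Runs.seq (R := fun s' => s' = s₃.set 11 (s₃.reg 10))
    (Prog.runs_of_wp (P := .instr (.copy 11 10)) rfl ⟨trivial, rfl⟩) ?_)
  rintro _ hf₄ rfl
  have hc₄ := hc₃.of_frame hf₄ (by decide) rfl rfl
  obtain ⟨x1, x2, x3⟩ := hx _ b10
  refine Runs.seq ((runs_closure (x := s₃.reg 10) hc₄ hW x2 (by simpa using b5) (by simp)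
    (by simp)).mono ?_ (fun _ _ h => h)) ?_
  · have hle : s₃.reg 10 ≤ n := (Nat.le_mul_self _).trans x1
    have : s₃.reg 10 * (s₃.reg 10 * (n * 20 + 7) + 5) =
      s₃.reg 10 * s₃.reg 10 * (n * 20 + 7) + s₃.reg 10 * 5 := by ring
    nlinarith [Nat.mul_le_mul_right (n * 20 + 7) x1]
  rintro s₅ hf₅ ⟨c5, c10, hcl⟩
  have hc₅ := hc₄.of_frame hf₅ (by decide) rfl rfl
  have e9 : s₅.reg 9 = 0 := by
    rw [hf₅.1 9 rfl, hf₄.1 9 rfl, hf₃.1 9 rfl, hf₂.1 9 rfl, hf₁.1 9 rfl, h9]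
  refine (runs_search hc₅ hW hp.k_mul_k_le c5 e9 rfl
    ((Nat.pow_le_pow_left c10 _).trans x3)).mono le_rfl ?_
  intro s₆ hf₆ h6
  refine ⟨by rwa [hf₆.2 5 rfl], ?_, h6.imp id fun h6 => ⟨h6.1, fun hgood => h6.2 ?_⟩⟩
  · rw [hf₆.2 7 rfl, hf₅.2 7 rfl]
    exact b7
  · rcases hgood with hw | hw
    · refine hT.hasTripleIn_of_window hp.one_le_k hp.le_r₁ hp.le_r hp.le_m hcl
        ((aw hw).trans (Finset.card_le_card (Finset.filter_subset_filter _ bsub)))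
    -- With fewer than m arcs, the tails and heads of the maximal matching would be a cover that the
    -- threshold rules out.
    · have hmq : m ≤ q := by
        by_contra hlt
        have hcard : ∀ g : ℕ → Fin n, ((Finset.range q).image g).card < m := fun g =>
          lt_of_le_of_lt Finset.card_image_le (by rw [Finset.card_range]; omega)
        obtain ⟨u, v, huv, hu, hv, huC, hvD⟩ := hw ((Finset.range q).image c)
          ((Finset.range q).image h) (hcard _) (hcard _)
          (by
            intro v hv
            obtain ⟨i, hi, rfl⟩ := Finset.mem_image.1 hv
            exact (bmem i (Finset.mem_range.1 hi)).2.2.2.1)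
          (by
            intro v hv
            obtain ⟨i, hi, rfl⟩ := Finset.mem_image.1 hv
            exact (bmem i (Finset.mem_range.1 hi)).2.2.2.2)
        rcases (bcov.resolve_left hlt) u v huv hu hv with ⟨i, hi, e⟩ | ⟨i, hi, e⟩
        · exact huC (Finset.mem_image.2 ⟨i, Finset.mem_range.2 hi, e⟩)
        · exact hvD (Finset.mem_image.2 ⟨i, Finset.mem_range.2 hi, e⟩)
      have hlt : ∀ i < m, i < q := fun i hi => hi.trans_le hmq
      refine hT.hasTripleIn_of_matching (d := d) hp.one_le_k hp.le_r₁ hp.le_r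
        (le_trans (Nat.pow_le_pow_right (by norm_num) (by omega)) hp.le_m) hcl
        (fun i hi j hj => bc i (hlt i hi) j (hlt j hj))
        (fun i hi j hj => bh i (hlt i hi) j (hlt j hj))
        (fun i hi => (bmem i (hlt i hi)).2.2.1)
        (fun i hi => ⟨(bmem i (hlt i hi)).1, (bmem i (hlt i hi)).2.1⟩)
        (fun i hi => (bmem i (hlt i hi)).2.2.2.1) (fun i hi => (bmem i (hlt i hi)).2.2.2.2)

/-! ### Outdegrees -/

/-- Writes the outdegrees to array `6`. -/
def degreeProg : Prog := .forLoop 12 0 (.forLoop 13 0 (.block [.arith .mul 15 12 0,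
  .arith .add 15 15 13, .load 15 0 15, .load 20 6 12, .arith .add 20 20 15, .store 6 12 20] .skip))

theorem runs_degree {n : ℕ} {T : Digraph (Fin n)} {W : ℕ} {s : State}
    (hW : n * n + n + 2 ≤ W) (h0 : s.reg 0 = n) (h3 : s.reg 3 = 1)
    (ha : ∀ u v : Fin n, s.arr 0 (u * n + v) = 1 ∧ T.Adj u v ∨
      s.arr 0 (u * n + v) = 0 ∧ ¬ T.Adj u v) (h6 : ∀ i, s.arr 6 i = 0) :
    Runs W degreeProg s (n * (n * 10 + 4) + 2) fun s' => ∀ v : Fin n, s'.arr 6 v = T.outDeg v := by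
  refine (Runs.forLoop (Tb := n * 10 + 2) (B := n) (fun j s' =>
      (∀ v : Fin n, v.1 < j → s'.arr 6 v = T.outDeg v) ∧ ∀ i, j ≤ i → s'.arr 6 i = 0)
    rfl rfl rfl (by decide) (by decide) h0 h3 (by nlinarith) (by exact fun _ _ _ h => h)
    (by simp [h6]) ?_).mono le_rfl (fun _ _ h v => h.1 v v.2)
  rintro j hj s₁ hf₁ hr₁ ⟨a1, a2⟩
  refine (Runs.forLoop (Tb := 8) (B := n) (fun p s' =>
      (∀ v : Fin n, v.1 < j → s'.arr 6 v = T.outDeg v) ∧ (∀ i, j < i → s'.arr 6 i = 0) ∧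
      s'.arr 6 j = ((T.outSet ⟨j, hj⟩).filter fun y => y.1 < p).card)
    rfl rfl rfl (by decide) (by decide) ((hf₁.1 0 rfl).trans h0) ((hf₁.1 3 rfl).trans h3)
    (by nlinarith) (by exact fun _ _ _ h => h)
    ⟨a1, fun i hi => a2 i hi.le, by simp [a2 j le_rfl]⟩ ?_).mono le_rfl ?_
  · rintro p hp s₂ hf₂ hr₂ ⟨b1, b2, b3⟩
    have e0 : s₂.reg 0 = n := (hf₂.1 0 rfl).trans ((hf₁.1 0 rfl).trans h0)
    have e12 : s₂.reg 12 = j := (hf₂.1 12 rfl).trans hr₁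
    have ea : s₂.arr 0 = s.arr 0 := (hf₂.2 0 rfl).trans (hf₁.2 0 rfl)
    have bj : j * n + n ≤ n * n := by
      have := Nat.mul_le_mul_right n (show j + 1 ≤ n by omega)
      rwa [Nat.succ_mul] at this
    have hle : s₂.arr 6 j ≤ n := by
      rw [b3]
      exact (Finset.card_le_univ _).trans (by simp)
    have hadj := ha ⟨j, hj⟩ ⟨p, hp⟩
    simp only at hadj
    have hnew : s₂.arr 6 j + s.arr 0 (j * n + p) =
        ((T.outSet ⟨j, hj⟩).filter fun y => y.1 < p + 1).card := by
      rcases hadj with ⟨g1, g2⟩ | ⟨g1, g2⟩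
      · have : (T.outSet ⟨j, hj⟩).filter (fun y => y.1 < p + 1) =
            insert (⟨p, hp⟩ : Fin n) ((T.outSet ⟨j, hj⟩).filter fun y => y.1 < p) := by
          ext y
          simp only [Finset.mem_filter, Finset.mem_insert, Digraph.mem_outSet, Fin.ext_iff]
          constructor
          · rintro ⟨k1, k2⟩
            rcases Nat.lt_succ_iff_lt_or_eq.1 k2 with k2 | k2
            · exact Or.inr ⟨k1, k2⟩
            · exact Or.inl k2
          · rintro (k1 | ⟨k1, k2⟩)
            · obtain rfl : y = ⟨p, hp⟩ := Fin.ext k1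
              exact ⟨g2, by simp⟩
            · exact ⟨k1, by omega⟩
        rw [this, Finset.card_insert_of_notMem (by simp), g1, b3]
      · rw [g1, b3, add_zero]
        congr 1
        ext y
        simp only [Finset.mem_filter, Digraph.mem_outSet, and_congr_right_iff]
        intro k1
        refine ⟨fun k2 => by omega, fun k2 => ?_⟩
        rcases Nat.lt_succ_iff_lt_or_eq.1 k2 with k2 | k2
        · exact k2
        · obtain rfl : y = ⟨p, hp⟩ := Fin.ext k2
          exact absurd k1 g2
    refine (Prog.runs_of_wp rfl ?_).mono (by decide) fun _ _ h => h
    simp only [Prog.block, List.foldr, Prog.wp, Instr.Fits, Instr.run_load,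
      Instr.run_store, Instr.run_arith, Op.eval, State.set_reg, State.set_arr,
      State.setArr_arr, hr₂, e0, e12, ea, hnew, reduceIte, Nat.reduceEqDiff, true_and]
    have hfin : ((T.outSet ⟨j, hj⟩).filter fun y => y.1 < p + 1).card ≤ n :=
      (Finset.card_le_univ _).trans (by simp)
    refine ⟨by omega, by omega, by omega, fun v hv => ?_, fun i hi => ?_, ?_⟩
    · rw [Function.update_of_ne hv.ne]
      exact b1 v hv
    · rw [Function.update_of_ne hi.ne']
      exact b2 i hi
    · rw [Function.update_self]
  · rintro s' - ⟨b1, b2, b3⟩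
    refine ⟨fun v hv => ?_, fun i hi => b2 i hi⟩
    rcases Nat.lt_succ_iff_lt_or_eq.1 hv with hv | hv
    · exact b1 v hv
    · obtain rfl : v = ⟨j, hj⟩ := Fin.ext hv
      rw [b3, Finset.filter_true_of_mem fun y _ => y.2]
      rfl

/-! ### Parameters -/

/-- The base of the exponential functions that the algorithm computes. -/
def expBase : ℕ := 16 ^ 112

/-- Writes the power of `reg 16` with exponent `reg y` to register `x`. -/
def powProg (x y : ℕ) : Prog :=
  .seq (.instr (.const x 1)) (.forLoop 12 y (.instr (.arith .mul x x 16)))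

theorem runs_pow {x y e W : ℕ} {s : State} (hx : x ≠ 12 ∧ x ≠ 3 ∧ x ≠ 16 ∧ x ≠ y)
    (hy : y ≠ 12) (h3 : s.reg 3 = 1) (h16 : s.reg 16 = expBase) (he : s.reg y = e)
    (hW : expBase ^ e < W) :
    Runs W (powProg x y) s (e * 3 + 3) fun s' => s'.reg x = expBase ^ e := by
  have hb : 1 < expBase := by norm_num [expBase]
  have heW : e < W := (Nat.lt_pow_self hb).trans hW
  refine (Runs.seq (T := 1) (T' := e * 3 + 2) (R := fun s' => s' = s.set x 1)
    (Prog.runs_of_wp rfl ?_) ?_).mono (by omega) (fun _ _ h => h)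
  · refine ⟨?_, rfl⟩
    have := Nat.one_le_pow e expBase (by omega)
    simp only [Instr.Fits]
    omega
  rintro _ - rfl
  refine (Runs.forLoop (Tb := 1) (B := e) (fun j s' => s'.reg x = expBase ^ j)
    (by simp [Prog.writesReg, Instr.writesReg, hx.1])
    (by simp [Prog.writesReg, Instr.writesReg, hx.2.2.2])
    (by simp [Prog.writesReg, Instr.writesReg, hx.2.1]) hy.symm (by decide)
    (by simp [hx.2.2.2.symm, he]) (by simp [hx.2.1.symm, h3]) heW
    (fun j s v h => by simpa [hx.1] using h) (by simp) ?_).mono le_rfl (fun _ _ h => h)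
  intro j hj s₁ hf₁ hr₁ hI
  have e16 : s₁.reg 16 = expBase := by
    rw [hf₁.1 16 (by simp [Prog.writesReg_forLoop, Prog.writesReg, Instr.writesReg, hx.2.2.1])]
    simp [hx.2.2.1.symm, h16]
  refine Prog.runs_of_wp (P := .instr _) rfl ?_
  simp only [Prog.wp, Instr.Fits, Instr.run_arith, Op.eval, State.set_reg, hI, e16, reduceIte,
    ← pow_succ, and_true]
  exact lt_of_le_of_lt (Nat.pow_le_pow_right (by omega) hj) hW

/-- Computes the parameters of the search. -/
def paramProg : Prog := .seq (.block [.const 3 1, .const 16 expBase] .skip)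
  (.seq (powProg 20 1) (.seq (powProg 21 20) (.seq (.block [.const 15 3, .arith .mul 5 15 21] .skip)
    (.seq (powProg 6 21) (.block [.const 15 3, .arith .mul 7 15 6] .skip)))))

/-- Only r₁, r and m are computed, by repeated multiplication; their exponents are below m, so the
time is O(m). -/
theorem runs_param {k r₁ r m W : ℕ} {s : State} (hk : s.reg 1 = k)
    (h₁ : r₁ = expBase ^ k) (h : r = expBase ^ r₁) (hm : m = expBase ^ r) (hW : 3 * m < W) :
    Runs W paramProg s (k * 3 + r₁ * 3 + r * 3 + 18) fun s' =>
      s'.reg 3 = 1 ∧ s'.reg 5 = 3 * r ∧ s'.reg 6 = m ∧ s'.reg 7 = 3 * m := by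
  have hb : 1 < expBase := by norm_num [expBase]
  have hkr : k < r₁ := h₁ ▸ Nat.lt_pow_self hb
  have hr₁r : r₁ < r := h ▸ Nat.lt_pow_self hb
  have hrm : r < m := hm ▸ Nat.lt_pow_self hb
  have hbr : expBase ≤ r := by
    rw [h]
    exact Nat.le_self_pow (by omega) _
  refine (Runs.seq (T := 3) (T' := (k * 3 + 3) + ((r₁ * 3 + 3) + (3 + ((r * 3 + 3) + 3))))
    (R := fun s' => s'.reg 3 = 1 ∧ s'.reg 16 = expBase) (Prog.runs_of_wp rfl ?_) ?_).mono
    (by omega) (fun _ _ h => h)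
  · simp only [Prog.block, List.foldr, Prog.wp, Instr.Fits, Instr.run_const, State.set_reg,
      reduceIte, Nat.reduceEqDiff]
    exact ⟨by omega, by omega, trivial, trivial⟩
  rintro s₁ hf₁ ⟨a3, a16⟩
  refine (runs_pow (e := k) (by decide) (by decide) a3 a16 ((hf₁.1 1 rfl).trans hk)
    (by omega)).seq ?_
  rintro s₂ hf₂ h20
  refine (runs_pow (e := r₁) (by decide) (by decide) ((hf₂.1 3 rfl).trans a3)
    ((hf₂.1 16 rfl).trans a16) (h20.trans h₁.symm) (by omega)).seq ?_
  rintro s₃ hf₃ h21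
  refine (Runs.seq (T := 3) (R := fun s' => s'.reg 5 = 3 * r) (Prog.runs_of_wp rfl ?_) ?_)
  · simp only [Prog.block, List.foldr, Prog.wp, Instr.Fits, Instr.run_const, Instr.run_arith,
      Op.eval, State.set_reg, h21, ← h, reduceIte, Nat.reduceEqDiff]
    exact ⟨by omega, by omega, trivial⟩
  rintro s₄ hf₄ h5
  refine (runs_pow (e := r) (by decide) (by decide)
    ((hf₄.1 3 rfl).trans ((hf₃.1 3 rfl).trans ((hf₂.1 3 rfl).trans a3)))
    ((hf₄.1 16 rfl).trans ((hf₃.1 16 rfl).trans ((hf₂.1 16 rfl).trans a16)))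
    ((hf₄.1 21 rfl).trans (h21.trans h.symm)) (by omega)).seq ?_
  rintro s₅ hf₅ h6
  refine Prog.runs_of_wp (P := .block _ .skip) rfl ?_
  simp only [Prog.block, List.foldr, Prog.wp, Instr.Fits, Instr.run_const, Instr.run_arith,
    Op.eval, State.set_reg, h6, ← hm, reduceIte, Nat.reduceEqDiff]
  refine ⟨by omega, by omega, ?_, ?_, trivial, trivial⟩
  · exact (hf₅.1 3 rfl).trans
      ((hf₄.1 3 rfl).trans ((hf₃.1 3 rfl).trans ((hf₂.1 3 rfl).trans a3)))
  · exact (hf₅.1 5 rfl).trans h5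

theorem params_of_le {k n : ℕ} (hk : 1 ≤ k)
    (hn : expBase ^ expBase ^ expBase ^ expBase ^ expBase ^ k ≤ n) :
    Params k (expBase ^ k) (expBase ^ expBase ^ k) (expBase ^ expBase ^ expBase ^ k) n := by
  have hb : 1 < expBase := by norm_num [expBase]
  -- 112 = 16 · 7, so `expBase ^ x` is the Ramsey bound for 7x vertices, the largest multiple
  -- needed.
  have hle : ∀ x, 16 ^ (16 * (7 * x)) ≤ expBase ^ x := fun x => by
    rw [expBase, ← pow_mul]
    exact Nat.pow_le_pow_right (by norm_num) (by omega)
  have hle' : ∀ {x y}, y ≤ 7 * x → 16 ^ (16 * y) ≤ expBase ^ x := fun h =>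
    (Nat.pow_le_pow_right (by norm_num) (by omega)).trans (hle _)
  set r₁ := expBase ^ k with hr₁
  set r := expBase ^ r₁ with hr
  set m := expBase ^ r with hm
  have hkr : k < r₁ := Nat.lt_pow_self hb
  have hr₁r : r₁ < r := Nat.lt_pow_self hb
  have hrm : r < m := Nat.lt_pow_self hb
  have hcube : 52 * (m * m * m) ≤ expBase ^ m := by
    have h1 : m ≤ 16 ^ m := (Nat.lt_pow_self (by norm_num : 1 < 16)).le
    have h2 : 16 ≤ 16 ^ m := Nat.le_self_pow (by omega) _
    have h3 : expBase ^ m = (16 ^ m) ^ 112 := by rw [expBase, ← pow_mul, ← pow_mul, mul_comm]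
    calc 52 * (m * m * m) ≤ (16 ^ m * 16 ^ m) * (16 ^ m * 16 ^ m * 16 ^ m) := by
          gcongr
          nlinarith
      _ = (16 ^ m) ^ 5 := by ring
      _ ≤ (16 ^ m) ^ 112 := Nat.pow_le_pow_right (by omega) (by norm_num)
      _ = expBase ^ m := h3.symm
  have hsize : (3 * m + 1) + (3 * m + 1) * (3 * m + 1) * (3 * r) ≤ expBase ^ m := by
    refine le_trans ?_ hcube
    -- Here 3m + 1 ≤ 4m and r ≤ m, so the size is at most 4m + 48m³ ≤ 52m³.
    have h1 : (3 * m + 1) * (3 * m + 1) * (3 * r) ≤ (4 * m) * (4 * m) * (3 * m) := by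
      gcongr <;> omega
    have h2 : m ≤ m * m * m := by nlinarith [Nat.le_mul_self m]
    nlinarith
  have hmn : expBase ^ m ≤ n := le_trans (Nat.lt_pow_self hb).le hn
  refine ⟨hk, hle' (by omega), hle' (by omega), hle r, by omega, by omega, ?_, ?_, ?_,
    hsize.trans hmn, ?_⟩
  · have : m ≤ m * m * m := by nlinarith [Nat.le_mul_self m]
    nlinarith
  · have h1 : k * k ≤ m * m := Nat.mul_le_mul (by omega) (by omega)
    have h2 : m * m ≤ m * m * m := Nat.le_mul_of_pos_right _ (by omega)
    omega
  · refine le_trans ?_ (hsize.trans hmn)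
    exact (Nat.le_mul_of_pos_right _ (by omega)).trans (Nat.le_add_left _ _)
  -- The closed list has at most `expBase ^ m` vertices, and raising this to the power 3k gives
  -- exponent 3km ≤ `expBase ^ m`. This needs the top level of the tower.
  · refine (Nat.pow_le_pow_left hsize _).trans (le_trans ?_ hn)
    rw [← pow_mul]
    refine Nat.pow_le_pow_right (by omega) (le_trans ?_ hcube)
    have h1 : m * (3 * k) ≤ m * (3 * m) := by gcongr; omega
    have h2 : m * m ≤ m * m * m := Nat.le_mul_of_pos_right _ (by omega)
    nlinarith

/-! ### The algorithm -/

/-- The algorithm. -/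
def tripleProg : Prog := .seq paramProg (.seq degreeProg (.forLoop 8 0
  (.ifThen (.eq 9 4) thresholdProg)))

theorem inputState_adj {n m : ℕ} (T : Digraph (Fin n)) (k : ℕ) (z : Fin m → Fin n) (u v : Fin n) :
    (inputState T k z).arr 0 (u * n + v) = 1 ∧ T.Adj u v ∨
      (inputState T k z).arr 0 (u * n + v) = 0 ∧ ¬ T.Adj u v := by
  have hiff : (∃ u' v' : Fin n, T.Adj u' v' ∧ (u : ℕ) * n + v = u' * n + v') ↔ T.Adj u v := by
    constructor
    · rintro ⟨u', v', h, e⟩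
      have hn : 0 < n := u.pos
      have e1 : (v : ℕ) = v' := by
        have := congrArg (· % n) e
        simpa only [Nat.mul_add_mod', Nat.mod_eq_of_lt v.2, Nat.mod_eq_of_lt v'.2] using this
      have e2 : (u : ℕ) = u' := by
        rw [e1] at e
        exact Nat.eq_of_mul_eq_mul_right hn (by omega)
      rwa [Fin.ext e1, Fin.ext e2]
    · exact fun h => ⟨u, v, h, rfl⟩
  by_cases h : T.Adj u v
  · left
    refine ⟨?_, h⟩
    simp only [inputState, if_true]
    exact if_pos (hiff.2 h)
  · right
    refine ⟨?_, h⟩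
    simp only [inputState, if_true]
    exact if_neg fun h' => h (hiff.1 h')

/-- There are n thresholds at 300 n² steps each, and success freezes the state through register 9.
If no threshold succeeded, none would be good. -/
theorem runs_triple {n : ℕ} {T : Digraph (Fin n)} (hT : T.IsSemicomplete) {k f W : ℕ}
    (hk : 1 ≤ k) (hn : expBase ^ expBase ^ expBase ^ expBase ^ expBase ^ k ≤ n)
    (hW : n * n + n + 2 ≤ W) (z : Fin f → Fin n)
    (hgood : ∃ d < n, GoodThreshold T (expBase ^ expBase ^ expBase ^ k)
      (3 * expBase ^ expBase ^ k) d) :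
    Runs W tripleProg (inputState T k z) (n ^ 3 * 400) (Found T k) := by
  have hb : 1 < expBase := by norm_num [expBase]
  have hp := params_of_le hk hn
  have hkr : k < expBase ^ k := Nat.lt_pow_self hb
  have hr₁r : expBase ^ k < expBase ^ expBase ^ k := Nat.lt_pow_self hb
  have hrm : expBase ^ expBase ^ k < expBase ^ expBase ^ expBase ^ k := Nat.lt_pow_self hb
  have hmn := hp.m_le
  have hn1 : 1 ≤ n := by omega
  have hnn : n ≤ n * n := Nat.le_mul_self n
  have hnnn : n * n ≤ n * n * n := Nat.le_mul_of_pos_right _ hn1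
  refine (Runs.seq (T' := (n * (n * 10 + 4) + 2) + (n * (n * n * 300 + 1 + 2) + 2))
    (runs_param (k := k) (by simp [inputState]) rfl rfl rfl (by omega)) ?_).mono ?_ (fun _ _ h => h)
  · rintro s₁ hf₁ ⟨h3, h5, h6, h7⟩
    have e0 : s₁.reg 0 = n := (hf₁.1 0 rfl).trans (by simp [inputState])
    have e1 : s₁.reg 1 = k := (hf₁.1 1 rfl).trans (by simp [inputState])
    have e4 : s₁.reg 4 = 0 := (hf₁.1 4 rfl).trans (by simp [inputState])
    have e9 : s₁.reg 9 = 0 := (hf₁.1 9 rfl).trans (by simp [inputState])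
    have ea : s₁.arr 0 = (inputState T k z).arr 0 := hf₁.2 0 rfl
    have ea5 : ∀ i, s₁.arr 5 i = 0 := fun i => by rw [hf₁.2 5 rfl]; simp [inputState]
    have ea6 : ∀ i, s₁.arr 6 i = 0 := fun i => by rw [hf₁.2 6 rfl]; simp [inputState]
    have ea7 : ∀ i, s₁.arr 7 i = 0 := fun i => by rw [hf₁.2 7 rfl]; simp [inputState]
    have hadj : ∀ u v : Fin n, s₁.arr 0 (u * n + v) = 1 ∧ T.Adj u v ∨
        s₁.arr 0 (u * n + v) = 0 ∧ ¬ T.Adj u v := by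
      rw [ea]
      exact inputState_adj T k z
    refine (runs_degree hW e0 h3 hadj ea6).seq ?_
    intro s₂ hf₂ hdeg
    have hc : Ctx T k (3 * expBase ^ expBase ^ k) (expBase ^ expBase ^ expBase ^ k) s₂ :=
      ⟨(hf₂.1 0 rfl).trans e0, (hf₂.1 1 rfl).trans e1, (hf₂.1 3 rfl).trans h3,
        (hf₂.1 4 rfl).trans e4, (hf₂.1 5 rfl).trans h5, (hf₂.1 6 rfl).trans h6,
        (hf₂.1 7 rfl).trans h7, by rw [hf₂.2 0 rfl]; exact hadj, hdeg⟩
    refine (Runs.forLoop (Tb := n * n * 300 + 1) (B := n) (fun d s' => (∀ i, s'.arr 5 i < n) ∧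
        (∀ i, d * n ≤ i → s'.arr 7 i = 0) ∧ (Found T k s' ∨ s'.reg 9 = 0 ∧ ∀ d' < d,
          ¬ GoodThreshold T (expBase ^ expBase ^ expBase ^ k) (3 * expBase ^ expBase ^ k) d'))
      rfl rfl rfl (by decide) (by decide) hc.reg_zero hc.reg_three (by omega)
      (by exact fun _ _ _ h => h) ?_ ?_).mono le_rfl ?_
    · refine ⟨fun i => ?_, fun i _ => ?_, Or.inr ⟨(hf₂.1 9 rfl).trans e9, by simp⟩⟩
      · rw [hf₂.2 5 rfl, ea5]; omega
      · rw [hf₂.2 7 rfl, ea7]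
    · rintro d hd s₃ hf₃ hr₃ ⟨a5, a7, hI⟩
      have hc₃ := hc.of_frame hf₃ (by decide) rfl rfl
      refine Runs.ite (fun hbt => ?_) (fun hbt => Runs.skip (by nlinarith) ?_)
      · have h0 : s₃.reg 9 = 0 := by simpa [Test.Holds, hc₃.reg_four] using hbt
        refine (runs_threshold hT hp hc₃ hW hd a5 a7 hr₃ h0).mono le_rfl ?_
        rintro s₄ - ⟨b5, b7, hF⟩
        refine ⟨b5, b7, hF.imp id fun hF => ⟨hF.1, fun d' hd' => ?_⟩⟩
        rcases Nat.lt_succ_iff_lt_or_eq.1 hd' with hd' | rfl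
        · rcases hI with hI | hI
          · exact absurd (hI.1.symm.trans h0) one_ne_zero
          · exact hI.2 d' hd'
        · exact hF.2
      · refine ⟨a5, fun i hi => a7 i (by rw [Nat.succ_mul] at hi; omega), Or.inl ?_⟩
        rcases hI with hI | hI
        · exact hI
        · exact absurd (by simp [Test.Holds, hc₃.reg_four, hI.1]) hbt
    · rintro s' - ⟨-, -, hF⟩
      rcases hF with hF | hF
      · exact hF
      · obtain ⟨d, hd, hg⟩ := hgood
        exact absurd hg (hF.2 d hd)
  · have e : n ^ 3 = n * n * n := by ring
    rw [e]
    nlinarith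

theorem Found.lists {n : ℕ} {T : Digraph (Fin n)} (hT : T.IsSemicomplete) {k : ℕ} {s : State}
    (h : Found T k s) : ∃ A B C : Finset (Fin n), T.IsTriple k A B C ∧
      s.Lists 2 k A ∧ s.Lists 3 k B ∧ s.Lists 4 k C := by
  obtain ⟨-, a, b, c, habc, h⟩ := h
  have key : ∀ {x : ℕ} {p : ℕ → Fin n}, (∀ i < k, s.arr x i = p i) →
      s.Lists x k ((Finset.range k).image p) := by
    intro x p hp
    rw [State.Lists, Finset.image_image]
    exact Finset.image_congr fun i hi => hp i (by simpa using hi)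
  exact ⟨_, _, _, habc.isTriple hT, key fun i hi => (h i hi).1, key fun i hi => (h i hi).2.1,
    key fun i hi => (h i hi).2.2⟩

end WordRAM

/-! ### Elementary functions -/

theorem KalmarElementary.const {n : ℕ} (c : ℕ) : KalmarElementary (fun _ : Fin n → ℕ => c) := by
  induction c with
  | zero => exact .zero
  | succ c ih => exact KalmarElementary.comp (h := fun _ _ => c) .succ fun _ => ih

/-- A power is a bounded product of a constant, without parameters. -/
theorem isElementaryFun_pow (c : ℕ) : IsElementaryFun fun x => c ^ x := by
  have h := KalmarElementary.bprod (n := 0) (KalmarElementary.const c)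
  simpa only [IsElementaryFun, Finset.prod_const, Finset.card_range] using h

theorem IsElementaryFun.comp {g f : ℕ → ℕ} (hg : IsElementaryFun g) (hf : IsElementaryFun f) :
    IsElementaryFun fun x => g (f x) :=
  KalmarElementary.comp (h := fun _ v => f (v 0)) hg fun _ => hf

theorem mainTheorem8 :
    ∃ f : ℕ → ℕ, IsElementaryFun f ∧
      ∃ (P : WordRAM.Prog) (c : ℕ) (K : ℝ),
        ∀ (k : ℕ), 1 ≤ k →
        ∀ (n : ℕ) (T : Digraph (Fin n)), T.IsSemicomplete →
        ∀ z : Fin (f k) ↪ Fin n, T.IsJungle (f k) (Finset.univ.map z) →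
          ∃ (t : ℕ) (s : WordRAM.State),
            WordRAM.Exec ((n + 1) ^ c) P (WordRAM.inputState T k z) t s ∧
            (t : ℝ) ≤ K * ((n : ℝ) ^ 3 * Real.log n) ∧
            ∃ A B C : Finset (Fin n), T.IsTriple k A B C ∧
              s.Lists 2 k A ∧ s.Lists 3 k B ∧ s.Lists 4 k C := by
  have he := isElementaryFun_pow WordRAM.expBase
  -- Three levels of the tower give r₁, r and m; the fourth bounds the closed list, and the fifth
  -- the number of its 3k-tuples.
  refine ⟨fun k => WordRAM.expBase ^ WordRAM.expBase ^ WordRAM.expBase ^ WordRAM.expBase ^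
    WordRAM.expBase ^ k, he.comp (he.comp (he.comp (he.comp he))), WordRAM.tripleProg, 3, 400, ?_⟩
  intro k hk n T hT z hZ
  have hn : WordRAM.expBase ^ WordRAM.expBase ^ WordRAM.expBase ^ WordRAM.expBase ^
      WordRAM.expBase ^ k ≤ n := by
    simpa using Fintype.card_le_of_embedding z
  have hp := WordRAM.params_of_le hk hn
  -- Taking n = f(k) here gives 3m + 2 ≤ f(k), so the separations used against the jungle have small
  -- enough order.
  have hp' := WordRAM.params_of_le hk le_rfl
  have hr := hp.one_le_r
  have hm := hp'.m_le
  have hmn := hp.m_le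
  obtain ⟨d, hd, hgood⟩ := hZ.exists_threshold (l := 3 * WordRAM.expBase ^ WordRAM.expBase ^ k)
    hp.one_le_m (by beta_reduce; omega) (by omega) hT
  obtain ⟨t, s, hexec, ht, hfound⟩ := WordRAM.runs_triple (W := (n + 1) ^ 3) hT hk hn
    (by have e : (n + 1) ^ 3 = n ^ 3 + 3 * (n * n) + 3 * n + 1 := by ring
        rw [e]
        have := hp.one_le_m
        omega) z ⟨d, by simpa using hd, hgood⟩
  refine ⟨t, s, hexec, ?_, hfound.lists hT⟩
  have h3 : (3 : ℝ) ≤ n := by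
    have := hp.one_le_m
    exact_mod_cast (by omega : 3 ≤ n)
  -- The running time is in fact O(n³); the logarithm is at least 1 because n ≥ 3 > e.
  have hlog : 1 ≤ Real.log n := by
    rw [Real.le_log_iff_exp_le (by linarith)]
    linarith [Real.exp_one_lt_d9]
  have ht' : (t : ℝ) ≤ n ^ 3 * 400 := by exact_mod_cast ht
  nlinarith [pow_nonneg (by linarith : (0 : ℝ) ≤ n) 3]
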